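/- **Setting.** A partial matching (chord diagram) is a finite graph on positive integers in which every vertex has degree at most one; its edges are written as arcs $(x,y)$, $x<y$. Its lattice presentation is the finite set $\Delta\subset\mathbb Z_{>0}^2$ that contains, for each arc $(x,y)$, the two points $(x,y)$ and $(y,x)$. Write $(x,y)^*=(y,x)$. For points $v=(a,b)$, $w=(c,d)$ let $R(v,w)$ be the rectangle with diagonal vertices $v,w$, of area $|c-a||d-b|$; the transformation $t(S,R(v,w))$ of a finite set $S\ni v,w$ replaces $v,w$ by $(c,b),(a,d)$. A transformation $\Delta\to\Delta'$ of lattice presentations is a sequence $\Delta=\Delta_0\to\Delta_1\to\dots\to\Delta_k=\Delta'$ in which $\Delta_j$ is obtained from $\Delta_{j-1}$ by transforming by $R_j=R(v_j,w_j)$ and by its mirror image $R_j^*=R(v_j^*,w_j^*)$, where $v_j,w_j\in\Delta_{j-1}$ present two distinct arcs. Its area is $\sum_j \mathrm{Area}(R_j)$, and it has minimal area if no transformation $\Delta\to\Delta'$ has smaller area. A lattice polytope $P$ is given by finite sets $\mathrm{Ver}_0(P),\mathrm{Ver}_1(P)\subset\mathbb Z^2$ of initial and terminal vertices, each with pairwise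 distinct $x$-components and pairwise distinct $y$-components, having the same set of $x$-components and the same set of $y$-components. Its edges join the distinct points of $\mathrm{Ver}_0(P)$ and $\mathrm{Ver}_1(P)$ that lie on a common horizontal line (oriented from $\mathrm{Ver}_0$ to $\mathrm{Ver}_1$) or on a common vertical line (oriented from $\mathrm{Ver}_1$ to $\mathrm{Ver}_0$); their union is $\partial P$, and the points of $\mathrm{Ver}_0(P)\cap\mathrm{Ver}_1(P)$ are isolated vertices. A crossing is a transverse intersection point of two edges. For $p\notin\partial P$ let $\omega(p)$ be the rotation number of $\partial P$ around $p$, and let $\mathrm{Area}|P|=\int_{\mathbb R^2}|\omega|$. As a subset of the plane, $P$ is the union of the closures of the components of $\mathbb R^2\setminus\partial P$ on which $\omega\ne0$, of $\partial P$, and of the vertices (isolated ones included). The polytope $-P^*$ has $\mathrm{Ver}_i(-P^*)=\mathrm{Ver}_i(P)^*$. $P$ is associated with $\Delta,\Delta'$ if $\Delta=\mathrm{Ver}_0(P)\sqcup\mathrm{Ver}_0(-P^*)$ and $\Delta'=\mathrm{Ver}_1(P)\sqcup\mathrm{Ver}_1(-P^*)$. **Statement.** Let $\Delta,\Delta'$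 be lattice presentations of partial matchings, let $P$ be a lattice polytope associated with $\Delta,\Delta'$ such that $P$ and $-P^*$ are disjoint, and let $\Delta=\Delta_0\to\dots\to\Delta_k=\Delta'$ be a transformation with minimal area. Suppose that $P$ satisfies (1) or (2): 1. there is $\epsilon\in\{+1,-1\}$ such that every embedded closed path in $\partial P$, oriented as $\partial P$, has rotation number $\epsilon$ with respect to the region it surrounds; 2. when crossings are regarded as vertices, $\partial P$ is divided into the oriented boundaries of simple polygons $P_1,\dots,P_m$ and $Q_{i1},\dots,Q_{in_i}$ $(1\le i\le m)$ such that, for $i\ne j$, $P_i\cap P_j$ is empty or consists of one crossing in $\partial P_i\cap\partial P_j$, and, for each $i$, $Q_{i1},\dots,Q_{in_i}$ are mutually disjoint and contained in the interior of $P_i$. Moreover, either there is no cyclic sequence of polygons among $P_1,\dots,P_m$ in which each polygon meets the next one at a crossing that is a terminal vertex of the former and an initial vertex of the latter (a vertex of an oriented polygon is terminal if a horizontal side ends there and a vertical side starts there, and initial if a vertical side ends there and a horizontal side starts there), or the given transformation has area $\mathrm{Area}|P|$. Then $\Delta\to\Delta'$ is described by a transformation of $P$: there are lattice polytopes $P=\Pi_0,\Pi_1,\dots,\Pi_k$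 with $\mathrm{Ver}_0(\Pi_k)=\mathrm{Ver}_1(P)$ and $\mathrm{Ver}_1(\Pi_j)=\mathrm{Ver}_1(P)$ for all $j$, such that, for each $j\geq 1$, one of the two rectangles $R_j$, $R_j^*$ has its diagonal vertices $v_j,w_j$ (respectively $v_j^*,w_j^*$) in $\mathrm{Ver}_0(\Pi_{j-1})$ and transforms $\mathrm{Ver}_0(\Pi_{j-1})$ into $\mathrm{Ver}_0(\Pi_j)$, and $\Delta_j=\mathrm{Ver}_0(\Pi_j)\cup\mathrm{Ver}_0(\Pi_j)^*$ for all $j$. Further, in each step the two arcs that are removed are nesting ($x_1<x_2<y_2<y_1$ up to order) and the two new arcs are crossing ($x_1<x_2<y_1<y_2$ up to order), or vice versa. -/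

import Mathlib

noncomputable section

namespace PartialMatching

/-- Points with integer coordinates. -/
abbrev Pt := ℤ × ℤ

/-- The corresponding point of the real plane. -/
def toPlane (a : Pt) : ℝ × ℝ := ((a.1 : ℝ), (a.2 : ℝ))

/-- The mirror image of a finite set of points in the line `x = y`; the image of a single point
`v` is `v.swap`. -/
def mirrorSet (S : Finset Pt) : Finset Pt := S.image Prod.swap

/-! ### Lattice presentations of partial matchings -/

/-- `Δ` is the lattice presentation of a partial matching (chord diagram) with vertices among the
positive integers: an arc joining `x < y` contributes the two points `(x, y)` and `(y, x)`, and
every vertex lies on at most one arc. -/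
structure IsLatticePresentation (Δ : Finset Pt) : Prop where
  pos : ∀ v ∈ Δ, 0 < v.1 ∧ 0 < v.2
  off_diag : ∀ v ∈ Δ, v.1 ≠ v.2
  symm : ∀ v ∈ Δ, v.swap ∈ Δ
  degree_le_one : Set.InjOn Prod.fst (Δ : Set Pt)

/-- The arc `(x, y)`, `x < y`, presented by a point off the diagonal. -/
def arc (v : Pt) : Pt := (min v.1 v.2, max v.1 v.2)

/-- Two arcs are nesting: `x₁ < x₂ < y₂ < y₁`, up to the order of the two arcs. -/
def Nesting (a b : Pt) : Prop :=
  (a.1 < b.1 ∧ b.1 < b.2 ∧ b.2 < a.2) ∨ (b.1 < a.1 ∧ a.1 < a.2 ∧ a.2 < b.2)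

/-- Two arcs are crossing: `x₁ < x₂ < y₁ < y₂`, up to the order of the two arcs. -/
def Crossing (a b : Pt) : Prop :=
  (a.1 < b.1 ∧ b.1 < a.2 ∧ a.2 < b.2) ∨ (b.1 < a.1 ∧ a.1 < b.2 ∧ b.2 < a.2)

/-! ### Transformations by rectangles -/

/-- `t(S, R(v, w))`: the diagonal vertices `v, w` of the rectangle `R(v, w)` are replaced by the
other two vertices. -/
def rectMove (S : Finset Pt) (v w : Pt) : Finset Pt :=
  (S \ {v, w}) ∪ {(w.1, v.2), (v.1, w.2)}

/-- `t(Δ, R(v, w) ∪ (-R(v, w)^*))`. -/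
def symMove (Δ : Finset Pt) (v w : Pt) : Finset Pt :=
  rectMove (rectMove Δ v w) v.swap w.swap

/-- A transformation `Δ = Δ₀ → Δ₁ → ⋯ → Δ_k = Δ'` of lattice presentations; the `j`-th step uses
the rectangle with diagonal vertices `v j`, `w j` and its mirror image, where `v j` and `w j`
present two distinct arcs of the current chord diagram. Only the values of `stage` at `j ≤ len`
and of `v`, `w` at `j < len` are relevant. -/
structure Transformation (Δ Δ' : Finset Pt) where
  len : ℕ
  stage : ℕ → Finset Pt
  v : ℕ → Pt
  w : ℕ → Pt
  stage_zero : stage 0 = Δ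
  stage_len : stage len = Δ'
  v_mem : ∀ j < len, v j ∈ stage j
  w_mem : ∀ j < len, w j ∈ stage j
  ne : ∀ j < len, w j ≠ v j
  ne_swap : ∀ j < len, w j ≠ (v j).swap
  stage_succ : ∀ j < len, stage (j + 1) = symMove (stage j) (v j) (w j)

/-- The area of a transformation: the sum over its steps of the (unsigned) areas of the
rectangles `R_j`. -/
def Transformation.area {Δ Δ' : Finset Pt} (T : Transformation Δ Δ') : ℤ :=
  ∑ j ∈ Finset.range T.len, |(T.w j).1 - (T.v j).1| * |(T.w j).2 - (T.v j).2|

/-- `T` has minimal area among all transformations `Δ → Δ'`. -/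
def Transformation.HasMinimalArea {Δ Δ' : Finset Pt} (T : Transformation Δ Δ') : Prop :=
  ∀ T' : Transformation Δ Δ', T.area ≤ T'.area

/-- In every step, the two arcs that are removed are nesting and the two new arcs are crossing, or
vice versa. -/
def Transformation.ExchangesNestingCrossing {Δ Δ' : Finset Pt} (T : Transformation Δ Δ') : Prop :=
  ∀ j < T.len,
    (Nesting (arc (T.v j)) (arc (T.w j)) ∧
      Crossing (arc ((T.w j).1, (T.v j).2)) (arc ((T.v j).1, (T.w j).2))) ∨
    (Crossing (arc (T.v j)) (arc (T.w j)) ∧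
      Nesting (arc ((T.w j).1, (T.v j).2)) (arc ((T.v j).1, (T.w j).2)))

/-! ### Lattice polytopes -/

/-- A lattice polytope, given by its sets of initial and terminal vertices. Each of the two sets
has at most one point on every horizontal and on every vertical line, and both occupy the same
lines; the polytope is determined by these data. The isolated vertices are the points of
`ver0 ∩ ver1`. -/
structure LatticePolytope where
  ver0 : Finset Pt
  ver1 : Finset Pt
  inj_x0 : Set.InjOn Prod.fst (ver0 : Set Pt)
  inj_y0 : Set.InjOn Prod.snd (ver0 : Set Pt)
  inj_x1 : Set.InjOn Prod.fst (ver1 : Set Pt)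
  inj_y1 : Set.InjOn Prod.snd (ver1 : Set Pt)
  same_x : ver0.image Prod.fst = ver1.image Prod.fst
  same_y : ver0.image Prod.snd = ver1.image Prod.snd

/-- The signed number of times (`1`, `0` or `-1`) the directed axis-parallel segment from `e.1` to
`e.2` crosses the horizontal ray going to the right from `p`, upward crossings being positive.
The lower end of the segment is counted, the upper one is not. -/
def rayCross (e : Pt × Pt) (p : ℝ × ℝ) : ℤ :=
  if p.1 < (e.1.1 : ℝ) ∧ (e.1.2 : ℝ) ≤ p.2 ∧ p.2 < (e.2.2 : ℝ) then 1
  else if p.1 < (e.1.1 : ℝ) ∧ (e.2.2 : ℝ) ≤ p.2 ∧ p.2 < (e.1.2 : ℝ) then -1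
  else 0

/-- `s` is a step of length one along the directed axis-parallel edge `e`, in the direction of
`e`. -/
def IsUnitStepOf (e s : Pt × Pt) : Prop :=
  (e.1.2 = e.2.2 ∧ s.1.2 = e.1.2 ∧ s.2.2 = e.1.2 ∧
    ((e.1.1 ≤ s.1.1 ∧ s.2.1 = s.1.1 + 1 ∧ s.2.1 ≤ e.2.1) ∨
     (e.2.1 ≤ s.2.1 ∧ s.1.1 = s.2.1 + 1 ∧ s.1.1 ≤ e.1.1))) ∨
  (e.1.1 = e.2.1 ∧ s.1.1 = e.1.1 ∧ s.2.1 = e.1.1 ∧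
    ((e.1.2 ≤ s.1.2 ∧ s.2.2 = s.1.2 + 1 ∧ s.2.2 ≤ e.2.2) ∨
     (e.2.2 ≤ s.2.2 ∧ s.1.2 = s.2.2 + 1 ∧ s.1.2 ≤ e.1.2)))

namespace LatticePolytope

/-- The edges in the `x`-direction, oriented from an initial to a terminal vertex. -/
def edgesX (P : LatticePolytope) : Finset (Pt × Pt) :=
  (P.ver0 ×ˢ P.ver1).filter fun e => e.1.2 = e.2.2 ∧ e.1 ≠ e.2

/-- The edges in the `y`-direction, oriented from a terminal to an initial vertex. -/
def edgesY (P : LatticePolytope) : Finset (Pt × Pt) :=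
  (P.ver1 ×ˢ P.ver0).filter fun e => e.1.1 = e.2.1 ∧ e.1 ≠ e.2

def edges (P : LatticePolytope) : Finset (Pt × Pt) := P.edgesX ∪ P.edgesY

/-- `∂P`, the union of the edges. -/
def boundary (P : LatticePolytope) : Set (ℝ × ℝ) :=
  ⋃ e ∈ P.edges, segment ℝ (toPlane e.1) (toPlane e.2)

/-- The rotation number of `P` with respect to the region of `ℝ² \ ∂P` that contains `p`,
computed as the intersection number of `∂P` with a ray from `p` (used for `p ∉ ∂P` only). -/
def rot (P : LatticePolytope) (p : ℝ × ℝ) : ℤ := ∑ e ∈ P.edges, rayCross e p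

/-- `P` as a subset of the plane: the closures of the regions of nonzero rotation number, the
edges, and the vertices, isolated vertices included. -/
def carrier (P : LatticePolytope) : Set (ℝ × ℝ) :=
  closure {p | p ∉ P.boundary ∧ P.rot p ≠ 0} ∪ P.boundary ∪ toPlane '' (P.ver0 ∪ P.ver1 : Set Pt)

/-- `Area|P|`: the sum over the regions `A` of `ℝ² \ ∂P` of `|ω(A)| Area(A)`. -/
def absArea (P : LatticePolytope) : ℝ := ∫ p : ℝ × ℝ, |(P.rot p : ℝ)|

/-- `-P^*`: the mirror image of `P` in the line `x = y` with reversed orientation. The reversal is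
implicit: reflection exchanges the edges in the `x`- and `y`-directions. -/
def negMirror (P : LatticePolytope) : LatticePolytope where
  ver0 := mirrorSet P.ver0
  ver1 := mirrorSet P.ver1
  inj_x0 := by
    intro a ha b hb h
    simp only [mirrorSet, Finset.coe_image, Set.mem_image] at ha hb
    obtain ⟨a, ha, rfl⟩ := ha
    obtain ⟨b, hb, rfl⟩ := hb
    rw [P.inj_y0 ha hb h]
  inj_y0 := by
    intro a ha b hb h
    simp only [mirrorSet, Finset.coe_image, Set.mem_image] at ha hb
    obtain ⟨a, ha, rfl⟩ := ha
    obtain ⟨b, hb, rfl⟩ := hb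
    rw [P.inj_x0 ha hb h]
  inj_x1 := by
    intro a ha b hb h
    simp only [mirrorSet, Finset.coe_image, Set.mem_image] at ha hb
    obtain ⟨a, ha, rfl⟩ := ha
    obtain ⟨b, hb, rfl⟩ := hb
    rw [P.inj_y1 ha hb h]
  inj_y1 := by
    intro a ha b hb h
    simp only [mirrorSet, Finset.coe_image, Set.mem_image] at ha hb
    obtain ⟨a, ha, rfl⟩ := ha
    obtain ⟨b, hb, rfl⟩ := hb
    rw [P.inj_x1 ha hb h]
  same_x := by
    have h := P.same_y
    simpa [mirrorSet, Finset.image_image, Function.comp_def] using h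
  same_y := by
    have h := P.same_x
    simpa [mirrorSet, Finset.image_image, Function.comp_def] using h

/-- `Ver₁(P)` regarded as a lattice polytope consisting of isolated vertices. -/
def terminal (P : LatticePolytope) : LatticePolytope where
  ver0 := P.ver1
  ver1 := P.ver1
  inj_x0 := P.inj_x1
  inj_y0 := P.inj_y1
  inj_x1 := P.inj_x1
  inj_y1 := P.inj_y1
  same_x := rfl
  same_y := rfl

/-- `P' = t(P, R(v, w))` for two distinct initial vertices `v, w` of `P`. -/
def IsRectMove (P P' : LatticePolytope) (v w : Pt) : Prop :=
  v ∈ P.ver0 ∧ w ∈ P.ver0 ∧ v ≠ w ∧ P'.ver0 = rectMove P.ver0 v w ∧ P'.ver1 = P.ver1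

/-- `P` is a lattice polytope associated with `Δ` and `Δ'`: the initial (terminal) vertices of `P`
and `-P^*` together are the points of `Δ` (of `Δ'`), each of the two having half of them. -/
structure IsAssociated (P : LatticePolytope) (Δ Δ' : Finset Pt) : Prop where
  union0 : P.ver0 ∪ P.negMirror.ver0 = Δ
  union1 : P.ver1 ∪ P.negMirror.ver1 = Δ'
  disjoint0 : Disjoint P.ver0 P.negMirror.ver0
  disjoint1 : Disjoint P.ver1 P.negMirror.ver1

/-- The steps of length one along the oriented edges of `P`. -/
def steps (P : LatticePolytope) : Set (Pt × Pt) := {s | ∃ e ∈ P.edges, IsUnitStepOf e s}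

/-- `x` is a transverse intersection point of two edges of `P`. -/
def IsCrossing (P : LatticePolytope) (x : Pt) : Prop :=
  ∃ e ∈ P.edgesX, ∃ f ∈ P.edgesY,
    toPlane x ∈ openSegment ℝ (toPlane e.1) (toPlane e.2) ∧
    toPlane x ∈ openSegment ℝ (toPlane f.1) (toPlane f.2)

end LatticePolytope

/-- The transformation `T` is described by a transformation `P = P₀ → P₁ → ⋯ → P_k = Ver₁(P)` of
`P` alone: for every `j`, one of the two rectangles `R_j`, `-R_j^*` has its diagonal vertices in
`Ver₀(P_{j-1})`, this rectangle transforms `P_{j-1}` into `P_j`, and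
`Δ_j = Ver₀(P_j ∪ (-P_j^*))`. -/
def Transformation.IsDescribedBy {Δ Δ' : Finset Pt} (T : Transformation Δ Δ')
    (P : LatticePolytope) : Prop :=
  ∃ Q : ℕ → LatticePolytope, Q 0 = P ∧ Q T.len = P.terminal ∧
    (∀ j < T.len, (Q j).IsRectMove (Q (j + 1)) (T.v j) (T.w j) ∨
      (Q j).IsRectMove (Q (j + 1)) (T.v j).swap (T.w j).swap) ∧
    ∀ j ≤ T.len, T.stage j = (Q j).ver0 ∪ (Q j).negMirror.ver0

/-! ### Embedded closed paths and simple polygons -/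

/-- A cyclic sequence of distinct integer points. It is used only when each point is followed by
a neighbour in one of the four axis directions; it then is an oriented embedded closed path, which
bounds a simple polygon. -/
structure LatticeCycle where
  len : ℕ
  pt : ℕ → Pt
  len_pos : 0 < len
  closed : pt len = pt 0
  inj : Set.InjOn pt (Set.Iio len)

namespace LatticeCycle

def steps (c : LatticeCycle) : Set (Pt × Pt) := {s | ∃ i < c.len, s = (c.pt i, c.pt (i + 1))}

/-- The closed path as a subset of the plane. -/
def trace (c : LatticeCycle) : Set (ℝ × ℝ) :=
  ⋃ i ∈ Finset.range c.len, segment ℝ (toPlane (c.pt i)) (toPlane (c.pt (i + 1)))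

/-- The rotation number of the closed path around `p` (used for `p` off the path only). -/
def rot (c : LatticeCycle) (p : ℝ × ℝ) : ℤ :=
  ∑ i ∈ Finset.range c.len, rayCross (c.pt i, c.pt (i + 1)) p

/-- The open region surrounded by the closed path. -/
def inside (c : LatticeCycle) : Set (ℝ × ℝ) := {p | p ∉ c.trace ∧ c.rot p ≠ 0}

/-- The closed region bounded by the closed path. -/
def region (c : LatticeCycle) : Set (ℝ × ℝ) := c.inside ∪ c.trace

/-- The path runs along the edges of `P`, following their orientations. -/
def InBoundary (c : LatticeCycle) (P : LatticePolytope) : Prop := c.steps ⊆ P.steps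

/-- The initial vertices of the polygon: a vertical side ends and a horizontal side starts. -/
def ver0 (c : LatticeCycle) : Set Pt :=
  {x | ∃ a b, (a, x) ∈ c.steps ∧ (x, b) ∈ c.steps ∧ a.1 = x.1 ∧ x.2 = b.2}

/-- The terminal vertices of the polygon: a horizontal side ends and a vertical side starts. -/
def ver1 (c : LatticeCycle) : Set Pt :=
  {x | ∃ a b, (a, x) ∈ c.steps ∧ (x, b) ∈ c.steps ∧ a.2 = x.2 ∧ x.1 = b.1}

end LatticeCycle

/-- A presentation of `P`, with crossings regarded as vertices, as the union of simple polytopes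
`P_i = outer i` and `Q_{ij} = inner i j` such that two different `P_i` are disjoint or share
exactly one point, a crossing lying on both their boundaries, and such that the `Q_{ij}` are, for
each `i`, mutually disjoint and contained in the interior of `P_i`. -/
structure SimpleDecomposition (P : LatticePolytope) where
  m : ℕ
  n : Fin m → ℕ
  outer : Fin m → LatticeCycle
  inner : (i : Fin m) → Fin (n i) → LatticeCycle
  outer_inBoundary : ∀ i, (outer i).InBoundary P
  inner_inBoundary : ∀ i j, (inner i j).InBoundary P
  partition : ∀ s ∈ P.steps, ∃! k : Fin m ⊕ (Σ i : Fin m, Fin (n i)),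
    s ∈ (Sum.elim outer (fun q => inner q.1 q.2) k).steps
  outer_inter : ∀ i j, i ≠ j → Disjoint (outer i).region (outer j).region ∨
    ∃ x, P.IsCrossing x ∧ toPlane x ∈ (outer i).trace ∩ (outer j).trace ∧
      (outer i).region ∩ (outer j).region = {toPlane x}
  inner_disjoint : ∀ i j k, j ≠ k → Disjoint (inner i j).region (inner i k).region
  inner_subset : ∀ i j, (inner i j).region ⊆ (outer i).inside

/-- There is no cyclic sequence of polygons `P_{i₁}, …, P_{i_r}, P_{i₁}` in which each polygon
meets the next one at a crossing that is a terminal vertex of the former and an initial vertex of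
the latter. -/
def SimpleDecomposition.NoDirectedCycle {P : LatticePolytope} (D : SimpleDecomposition P) : Prop :=
  ∀ i, ¬ Relation.TransGen (fun i j => ∃ x, x ∈ (D.outer i).ver1 ∧ x ∈ (D.outer j).ver0) i i

namespace LatticePolytope

/-- `P` and `-P^*` are disjoint. -/
def DisjointFromMirror (P : LatticePolytope) : Prop := Disjoint P.carrier P.negMirror.carrier

/-- Condition (1): all embedded closed paths in `∂P`, oriented as `∂P`, have the same rotation
number `ε ∈ {1, -1}` with respect to the regions they surround. -/
def Condition1 (P : LatticePolytope) : Prop :=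
  ∃ ε : ℤ, (ε = 1 ∨ ε = -1) ∧
    ∀ c : LatticeCycle, c.InBoundary P → ∀ p ∈ c.inside, c.rot p = ε

end LatticePolytope

end PartialMatching

end

noncomputable section

namespace PartialMatching

/-! ### Rectangle moves and counting functions -/

/-! For a finite set S let `cnt S` count the points of S weakly to the left of and below a unit
square. A rectangle move changes `cnt` by 1 or -1 on the squares of the rectangle and nowhere else,
and the rotation number of P on a square is `cnt Ver₀(P) - cnt Ver₁(P)` (`rot_eq_faceRot`). Hence
every square is covered by at least |cnt Δ - cnt Δ'| of the rectangles R_j, R_j^*. As P and -P^* are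
disjoint, no cancellation occurs between them, and these lower bounds add up to 2 Area|P|.

If a transformation has area at most Area|P|, equality holds on every square, so the rectangles
cover only squares of P and of -P^* (`rectFaces_subset`). Squares of P and of -P^* have no common
corner, so each rectangle lies in one of the two (`rect_in_part`), and the transformation can be
replayed in P alone (`isDescribedBy_of_area_le`). A rectangle containing a diagonal square would
meet both P and -P^*; a rectangle off the diagonal exchanges nesting and crossing arcs
(`exchanges_of_area_le`).

It remains to bound the minimal area by Area|P|. A chain of rectangle moves from Ver₀(P) to Ver₁(P)
of area Area|P| suffices, since it can be mirrored. When the rotation number has constant sign, such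
a chain comes from a greedy argument as for the Bruhat order of permutations (`rectChain_of_sign`).
Condition (1) yields the constant sign by peeling embedded closed paths off the boundary
(`sign_of_cycles`). Under (2), each P_i together with its holes has a rotation function of constant
sign, and these functions have disjoint supports. The parts are processed one at a time, always
choosing one that has no initial vertex in common with the terminal vertices of an unprocessed part
(`rectChain_of_noDirectedCycle`). If there are directed cycles, the area is Area|P| by hypothesis.
-/

/-- At most one point on every vertical and on every horizontal line. -/
def BiInj (S : Finset Pt) : Prop :=
  ∀ p ∈ S, ∀ q ∈ S, (p.1 = q.1 → p = q) ∧ (p.2 = q.2 → p = q)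

/-- The two sets occupy the same vertical and the same horizontal lines. -/
def SameLines (S T : Finset Pt) : Prop :=
  S.image Prod.fst = T.image Prod.fst ∧ S.image Prod.snd = T.image Prod.snd

theorem SameLines.symm {S T : Finset Pt} (h : SameLines S T) : SameLines T S :=
  ⟨h.1.symm, h.2.symm⟩

theorem SameLines.trans {S T U : Finset Pt} (h : SameLines S T) (h' : SameLines T U) :
    SameLines S U :=
  ⟨h.1.trans h'.1, h.2.trans h'.2⟩

theorem SameLines.exists_fst {S T : Finset Pt} (h : SameLines S T) {p : Pt} (hp : p ∈ S) :
    ∃ q ∈ T, q.1 = p.1 := by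
  have : p.1 ∈ T.image Prod.fst := h.1 ▸ Finset.mem_image_of_mem _ hp
  simpa using Finset.mem_image.1 this

theorem SameLines.exists_snd {S T : Finset Pt} (h : SameLines S T) {p : Pt} (hp : p ∈ S) :
    ∃ q ∈ T, q.2 = p.2 := by
  have : p.2 ∈ T.image Prod.snd := h.2 ▸ Finset.mem_image_of_mem _ hp
  simpa using Finset.mem_image.1 this

theorem SameLines.of_exists {S T : Finset Pt}
    (h1 : ∀ p ∈ S, ∃ q ∈ T, q.1 = p.1) (h2 : ∀ p ∈ T, ∃ q ∈ S, q.1 = p.1)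
    (h3 : ∀ p ∈ S, ∃ q ∈ T, q.2 = p.2) (h4 : ∀ p ∈ T, ∃ q ∈ S, q.2 = p.2) :
    SameLines S T := by
  constructor <;> ext a <;> simp only [Finset.mem_image] <;> constructor <;> rintro ⟨p, hp, rfl⟩
  exacts [h1 p hp, h2 p hp, h3 p hp, h4 p hp]

theorem mem_rectMove {S : Finset Pt} {v w x : Pt} :
    x ∈ rectMove S v w ↔ (x ∈ S ∧ x ≠ v ∧ x ≠ w) ∨ x = (w.1, v.2) ∨ x = (v.1, w.2) := by
  simp only [rectMove, Finset.mem_union, Finset.mem_sdiff, Finset.mem_insert, Finset.mem_singleton,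
    not_or]

theorem BiInj.fst_ne {S : Finset Pt} (hS : BiInj S) {v w : Pt} (hv : v ∈ S) (hw : w ∈ S)
    (h : v ≠ w) : v.1 ≠ w.1 := fun h' => h ((hS v hv w hw).1 h')

theorem BiInj.snd_ne {S : Finset Pt} (hS : BiInj S) {v w : Pt} (hv : v ∈ S) (hw : w ∈ S)
    (h : v ≠ w) : v.2 ≠ w.2 := fun h' => h ((hS v hv w hw).2 h')

theorem BiInj.rectMove {S : Finset Pt} (hS : BiInj S) {v w : Pt} (hv : v ∈ S) (hw : w ∈ S)
    (h : v ≠ w) : BiInj (rectMove S v w) := by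
  have h1 := hS.fst_ne hv hw h
  have h2 := hS.snd_ne hv hw h
  intro p hp q hq
  rw [mem_rectMove] at hp hq
  rcases hp with ⟨hp, hpv, hpw⟩ | rfl | rfl <;> rcases hq with ⟨hq, hqv, hqw⟩ | rfl | rfl
  · exact hS p hp q hq
  · exact ⟨fun e => absurd ((hS p hp w hw).1 e) hpw, fun e => absurd ((hS p hp v hv).2 e) hpv⟩
  · exact ⟨fun e => absurd ((hS p hp v hv).1 e) hpv, fun e => absurd ((hS p hp w hw).2 e) hpw⟩
  · exact ⟨fun e => absurd ((hS q hq w hw).1 e.symm) hqw,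
      fun e => absurd ((hS q hq v hv).2 e.symm) hqv⟩
  · exact ⟨fun _ => rfl, fun _ => rfl⟩
  · exact ⟨fun e => absurd e.symm h1, fun e => absurd e h2⟩
  · exact ⟨fun e => absurd ((hS q hq v hv).1 e.symm) hqv,
      fun e => absurd ((hS q hq w hw).2 e.symm) hqw⟩
  · exact ⟨fun e => absurd e h1, fun e => absurd e.symm h2⟩
  · exact ⟨fun _ => rfl, fun _ => rfl⟩

theorem sameLines_rectMove {S : Finset Pt} {v w : Pt} (hv : v ∈ S) (hw : w ∈ S) :
    SameLines S (rectMove S v w) := by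
  refine SameLines.of_exists ?_ ?_ ?_ ?_ <;> intro p hp
  · by_cases hpv : p = v
    · exact ⟨(v.1, w.2), mem_rectMove.2 (by simp), by simp [hpv]⟩
    by_cases hpw : p = w
    · exact ⟨(w.1, v.2), mem_rectMove.2 (by simp), by simp [hpw]⟩
    exact ⟨p, mem_rectMove.2 (Or.inl ⟨hp, hpv, hpw⟩), rfl⟩
  · rcases mem_rectMove.1 hp with h | rfl | rfl
    exacts [⟨p, h.1, rfl⟩, ⟨w, hw, rfl⟩, ⟨v, hv, rfl⟩]
  · by_cases hpv : p = v
    · exact ⟨(w.1, v.2), mem_rectMove.2 (by simp), by simp [hpv]⟩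
    by_cases hpw : p = w
    · exact ⟨(v.1, w.2), mem_rectMove.2 (by simp), by simp [hpw]⟩
    exact ⟨p, mem_rectMove.2 (Or.inl ⟨hp, hpv, hpw⟩), rfl⟩
  · rcases mem_rectMove.1 hp with h | rfl | rfl
    exacts [⟨p, h.1, rfl⟩, ⟨v, hv, rfl⟩, ⟨w, hw, rfl⟩]

/-- The indicator function of the quadrant with lower left corner `x`. -/
def quad (x p : Pt) : ℤ := if x.1 ≤ p.1 ∧ x.2 ≤ p.2 then 1 else 0

/-- The number of points of `S` weakly to the left of and below `p`. -/
def cnt (S : Finset Pt) (p : Pt) : ℤ := ∑ x ∈ S, quad x p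

/-- The unit squares, named by their lower left corners, of the rectangle `R(v, w)`. -/
def rectFaces (v w : Pt) : Finset Pt :=
  Finset.Ico (min v.1 w.1) (max v.1 w.1) ×ˢ Finset.Ico (min v.2 w.2) (max v.2 w.2)

theorem mem_rectFaces {v w p : Pt} : p ∈ rectFaces v w ↔
    (min v.1 w.1 ≤ p.1 ∧ p.1 < max v.1 w.1) ∧ (min v.2 w.2 ≤ p.2 ∧ p.2 < max v.2 w.2) := by
  simp [rectFaces, Finset.mem_product]

theorem card_rectFaces (v w : Pt) :
    ((rectFaces v w).card : ℤ) = |w.1 - v.1| * |w.2 - v.2| := by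
  have key : ∀ a b : ℤ, ((max a b - min a b).toNat : ℤ) = |b - a| := by
    intro a b
    rw [Int.toNat_of_nonneg (by simp), max_sub_min_eq_abs']
    exact abs_sub_comm _ _
  rw [rectFaces, Finset.card_product, Int.card_Ico, Int.card_Ico]
  push_cast
  rw [← key, ← key]

theorem cnt_rectMove {S : Finset Pt} (hS : BiInj S) {v w : Pt} (hv : v ∈ S) (hw : w ∈ S)
    (h : v ≠ w) (p : Pt) :
    cnt (rectMove S v w) p =
      cnt S p - (quad v p + quad w p - quad (w.1, v.2) p - quad (v.1, w.2) p) := by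
  have h1 := hS.fst_ne hv hw h
  have h2 := hS.snd_ne hv hw h
  have e1 : (w.1, v.2) ∉ S := fun hm => h1 ((hS _ hm v hv).2 rfl ▸ rfl)
  have e2 : (v.1, w.2) ∉ S := fun hm => h2 ((hS _ hm v hv).1 rfl ▸ rfl)
  have e3 : ((w.1, v.2) : Pt) ≠ (v.1, w.2) := fun e => h1 (congrArg Prod.fst e).symm
  have hd : Disjoint (S \ {v, w}) ({(w.1, v.2), (v.1, w.2)} : Finset Pt) := by
    rw [Finset.disjoint_right]
    intro x hx hx'
    simp only [Finset.mem_insert, Finset.mem_singleton] at hx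
    rcases hx with rfl | rfl
    exacts [e1 (Finset.mem_sdiff.1 hx').1, e2 (Finset.mem_sdiff.1 hx').1]
  have hsub : ({v, w} : Finset Pt) ⊆ S := by
    intro x hx
    simp only [Finset.mem_insert, Finset.mem_singleton] at hx
    rcases hx with rfl | rfl <;> assumption
  unfold cnt PartialMatching.rectMove
  rw [Finset.sum_union hd, Finset.sum_pair e3]
  have := Finset.sum_sdiff (f := fun x => quad x p) hsub
  rw [Finset.sum_pair h] at this
  linarith

theorem quad_rect_pos {v w : Pt} (h1 : v.1 < w.1) (h2 : v.2 < w.2) (p : Pt) :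
    quad v p + quad w p - quad (w.1, v.2) p - quad (v.1, w.2) p =
      if p ∈ rectFaces v w then 1 else 0 := by
  simp only [quad, mem_rectFaces, min_eq_left h1.le, min_eq_left h2.le, max_eq_right h1.le,
    max_eq_right h2.le]
  split_ifs <;> omega

/-- The sign depends on whether the diagonal from `v` to `w` rises or falls; for estimating how
often a square is covered only the modulus matters. -/
theorem abs_quad_rect {v w : Pt} (p : Pt) :
    |quad v p + quad w p - quad (w.1, v.2) p - quad (v.1, w.2) p| =
      if p ∈ rectFaces v w then 1 else 0 := by
  simp only [quad, mem_rectFaces]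
  rcases le_total v.1 w.1 with h1 | h1 <;> rcases le_total v.2 w.2 with h2 | h2 <;>
    simp only [h1, h2, min_eq_left, min_eq_right, max_eq_right, max_eq_left] <;>
    rw [abs_eq (by split_ifs <;> omega)] <;> split_ifs <;> omega

/-! ### Chains of rectangle moves and their area -/

/-- `S` is transformed into `T` by a sequence of rectangle moves of total area `n`. -/
inductive RectChain : Finset Pt → Finset Pt → ℤ → Prop
  | refl (S : Finset Pt) : RectChain S S 0
  | step {S T : Finset Pt} {n : ℤ} (v w : Pt) : v ∈ S → w ∈ S → v ≠ w →
      RectChain (rectMove S v w) T n → RectChain S T (|w.1 - v.1| * |w.2 - v.2| + n)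

theorem RectChain.trans {S T U : Finset Pt} {m n : ℤ} (h : RectChain S T m)
    (h' : RectChain T U n) : RectChain S U (m + n) := by
  induction h with
  | refl S => simpa using h'
  | step v w hv hw hvw _ ih =>
    rw [add_assoc]
    exact .step v w hv hw hvw (ih h')

theorem rectMove_rectMove {S : Finset Pt} (hS : BiInj S) {v w : Pt} (hv : v ∈ S) (hw : w ∈ S)
    (h : v ≠ w) : rectMove (rectMove S v w) (w.1, v.2) (v.1, w.2) = S := by
  have h1 := hS.fst_ne hv hw h
  have h2 := hS.snd_ne hv hw h
  have e1 : (w.1, v.2) ∉ S := fun hm => h1 ((hS _ hm v hv).2 rfl ▸ rfl)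
  have e2 : (v.1, w.2) ∉ S := fun hm => h2 ((hS _ hm v hv).1 rfl ▸ rfl)
  ext x
  simp only [mem_rectMove, Prod.mk.eta]
  constructor
  · rintro (⟨hx | hx, hx'⟩ | hx | hx)
    · exact hx.1
    · tauto
    · exact hx ▸ hv
    · exact hx ▸ hw
  · intro hx
    by_cases hxv : x = v
    · simp [hxv]
    by_cases hxw : x = w
    · simp [hxw]
    exact Or.inl ⟨Or.inl ⟨hx, hxv, hxw⟩, fun e => e1 (e ▸ hx), fun e => e2 (e ▸ hx)⟩

theorem RectChain.reverse {S T : Finset Pt} {n : ℤ} (h : RectChain S T n) (hS : BiInj S) :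
    RectChain T S n := by
  induction h with
  | refl S => exact .refl S
  | @step S T n v w hv hw hvw _ ih =>
    have h1 := hS.fst_ne hv hw hvw
    have key : RectChain (PartialMatching.rectMove S v w) S
        (|(v.1, w.2).1 - (w.1, v.2).1| * |(v.1, w.2).2 - (w.1, v.2).2| + 0) := by
      refine .step (w.1, v.2) (v.1, w.2) (mem_rectMove.2 (by simp)) (mem_rectMove.2 (by simp))
        (fun e => h1 (congrArg Prod.fst e).symm) ?_
      rw [rectMove_rectMove hS hv hw hvw]
      exact .refl S
    have := (ih (hS.rectMove hv hw hvw)).trans key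
    simp only [add_zero] at this
    rwa [abs_sub_comm v.1 w.1, add_comm] at this

/-! ### The Bruhat order criterion -/

theorem cnt_eq_card (S : Finset Pt) (p : Pt) :
    cnt S p = ((S.filter fun x => x.1 ≤ p.1 ∧ x.2 ≤ p.2).card : ℤ) := by
  simp only [cnt, quad, Finset.card_filter]
  push_cast
  rfl

/-- The lower left corner `v` is the leftmost point at which S leaves T, and `u` is the point of T
in the same column. The upper right corner `w` is the first point of S to the right of `v` whose
height lies above `v` and not above `u`. Then S has no points that could use up the surplus of `cnt
S` over `cnt T` inside the rectangle. -/
theorem exists_rect_of_cnt_le {S T : Finset Pt} (hS : BiInj S) (hT : BiInj T)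
    (hST : SameLines S T) (hle : ∀ p, cnt T p ≤ cnt S p) (hne : S ≠ T) :
    ∃ v ∈ S, ∃ w ∈ S, v.1 < w.1 ∧ v.2 < w.2 ∧ ∀ p ∈ rectFaces v w, cnt T p + 1 ≤ cnt S p := by
  have hnon : (S \ T).Nonempty := by
    rw [Finset.nonempty_iff_ne_empty, Ne, Finset.sdiff_eq_empty_iff_subset]
    intro hsub
    refine hne (hsub.antisymm fun q hq => ?_)
    obtain ⟨p, hp, hpq⟩ := hST.symm.exists_fst hq
    exact (hT p (hsub hp) q hq).1 hpq ▸ hp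
  obtain ⟨v, hv, hvmin⟩ := Finset.exists_min_image (S \ T) Prod.fst hnon
  obtain ⟨hvS, hvT⟩ := Finset.mem_sdiff.1 hv
  have hleft : ∀ p ∈ S, p.1 < v.1 → p ∈ T := by
    intro p hp hlt
    by_contra hpT
    exact absurd (hvmin p (Finset.mem_sdiff.2 ⟨hp, hpT⟩)) (by omega)
  obtain ⟨u, huT, huv⟩ := hST.exists_fst hvS
  have huS : u ∉ S := fun h => hvT ((hS u h v hvS).1 huv ▸ huT)
  have hu2 : u.2 ≠ v.2 := fun h => huS ((Prod.ext huv h : u = v) ▸ hvS)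
  -- Otherwise `u` would lie below `v`, and T would have more points than S to the left of and below
  -- `u`.
  have hlt : v.2 < u.2 := by
    by_contra hcon
    have hcard : (S.filter fun x => x.1 ≤ v.1 ∧ x.2 ≤ u.2).card <
        (T.filter fun x => x.1 ≤ v.1 ∧ x.2 ≤ u.2).card := by
      refine Finset.card_lt_card (Finset.ssubset_iff_of_subset ?_ |>.2
        ⟨u, by simp [huT, huv], by simp [huS]⟩)
      intro p hp
      obtain ⟨hp, h1, h2⟩ := Finset.mem_filter.1 hp
      refine Finset.mem_filter.2 ⟨?_, h1, h2⟩
      rcases lt_or_eq_of_le h1 with h | h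
      · exact hleft p hp h
      · have := (hS p hp v hvS).1 h
        subst this
        omega
    have := hle (v.1, u.2)
    rw [cnt_eq_card, cnt_eq_card] at this
    simp only at this
    omega
  -- The point of S at the height of `u` is a candidate; left of `v` it would belong to T and
  -- coincide with `u`.
  have hcand : (S.filter fun x => v.1 < x.1 ∧ v.2 < x.2 ∧ x.2 ≤ u.2).Nonempty := by
    obtain ⟨z, hz, hzu⟩ := hST.symm.exists_snd huT
    refine ⟨z, Finset.mem_filter.2 ⟨hz, ?_, by omega, by omega⟩⟩
    by_contra hcon
    rcases lt_or_eq_of_le (not_lt.1 hcon) with h | h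
    · exact huS ((hT z (hleft z hz h) u huT).2 hzu ▸ hz)
    · have := (hS z hz v hvS).1 h
      subst this
      omega
  obtain ⟨w, hw, hwmin⟩ := Finset.exists_min_image _ Prod.fst hcand
  obtain ⟨hwS, hw1, hw2, hw3⟩ := Finset.mem_filter.1 hw
  refine ⟨v, hvS, w, hwS, hw1, hw2, fun p hp => ?_⟩
  rw [mem_rectFaces, min_eq_left hw1.le, min_eq_left hw2.le, max_eq_right hw1.le,
    max_eq_right hw2.le] at hp
  -- Compare `p` with the square above it at the height of `u`. In the strip between them, by the
  -- choice of `w`, all points of S lie to the left of `v` and so belong to T, while T contains `u`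
  -- in addition.
  have hsplit : ∀ U : Finset Pt, cnt U (p.1, u.2) = cnt U p +
      ((U.filter fun x => x.1 ≤ p.1 ∧ p.2 < x.2 ∧ x.2 ≤ u.2).card : ℤ) := by
    intro U
    simp only [cnt, Finset.card_filter]
    push_cast
    rw [← Finset.sum_add_distrib]
    refine Finset.sum_congr rfl fun x _ => ?_
    simp only [quad]
    split_ifs <;> omega
  have hcard : (S.filter fun x => x.1 ≤ p.1 ∧ p.2 < x.2 ∧ x.2 ≤ u.2).card <
      (T.filter fun x => x.1 ≤ p.1 ∧ p.2 < x.2 ∧ x.2 ≤ u.2).card := by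
    refine Finset.card_lt_card (Finset.ssubset_iff_of_subset ?_ |>.2
      ⟨u, Finset.mem_filter.2 ⟨huT, by omega, by omega, le_rfl⟩, by simp [huS]⟩)
    intro s hs
    obtain ⟨hs, h1, h2, h3⟩ := Finset.mem_filter.1 hs
    refine Finset.mem_filter.2 ⟨?_, h1, h2, h3⟩
    rcases lt_trichotomy s.1 v.1 with h | h | h
    · exact hleft s hs h
    · have := (hS s hs v hvS).1 h
      subst this
      omega
    · have := hwmin s (Finset.mem_filter.2 ⟨hs, h, by omega, h3⟩)
      omega
  have h1 := hsplit S
  have h2 := hsplit T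
  have h3 := hle (p.1, u.2)
  omega

/-- Each rectangle found by `exists_rect_of_cnt_le` lowers the difference by one on its squares and
keeps it nonnegative. No square is covered in vain, so the total area is exactly the sum of the
differences; this sum is also the induction variable. -/
theorem rectChain_of_cnt_le (K : Finset Pt) {S T : Finset Pt} (hS : BiInj S) (hT : BiInj T)
    (hST : SameLines S T) (hle : ∀ p, cnt T p ≤ cnt S p) (hK : ∀ p, p ∉ K → cnt S p = cnt T p) :
    RectChain S T (∑ p ∈ K, (cnt S p - cnt T p)) := by
  induction hn : (∑ p ∈ K, (cnt S p - cnt T p)).toNat using Nat.strong_induction_on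
    generalizing S with
  | _ n ih =>
    by_cases hne : S = T
    · subst hne
      simpa using RectChain.refl S
    obtain ⟨v, hv, w, hw, h1, h2, hR⟩ := exists_rect_of_cnt_le hS hT hST hle hne
    have hvw : v ≠ w := fun e => by simp [e] at h1
    have hcnt : ∀ p, cnt (rectMove S v w) p =
        cnt S p - if p ∈ rectFaces v w then 1 else 0 := fun p => by
      rw [cnt_rectMove hS hv hw hvw, quad_rect_pos h1 h2]
    have hRK : rectFaces v w ⊆ K := by
      intro p hp
      by_contra hpK
      have := hR p hp
      have := hK p hpK
      omega
    have hsum : ∑ p ∈ K, (cnt S p - cnt T p) = |w.1 - v.1| * |w.2 - v.2| +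
        ∑ p ∈ K, (cnt (rectMove S v w) p - cnt T p) := by
      rw [← card_rectFaces, ← Finset.inter_eq_right.2 hRK, ← Finset.filter_mem_eq_inter,
        Finset.card_filter]
      push_cast
      rw [← Finset.sum_add_distrib]
      refine Finset.sum_congr rfl fun p _ => ?_
      rw [hcnt]
      ring
    have hle' : ∀ p, cnt T p ≤ cnt (rectMove S v w) p := by
      intro p
      rw [hcnt]
      have := hle p
      split_ifs with hp
      · have := hR p hp
        omega
      · omega
    have hpos : 0 < |w.1 - v.1| * |w.2 - v.2| :=
      mul_pos (abs_pos.2 (by omega)) (abs_pos.2 (by omega))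
    have hnonneg : 0 ≤ ∑ p ∈ K, (cnt (rectMove S v w) p - cnt T p) :=
      Finset.sum_nonneg fun p _ => by have := hle' p; omega
    rw [hsum]
    refine .step v w hv hw hvw (ih _ (by omega) (hS.rectMove hv hw hvw)
      ((sameLines_rectMove hv hw).symm.trans hST) hle' ?_ rfl)
    intro p hp
    rw [hcnt, hK p hp, if_neg fun h => hp (hRK h), sub_zero]

/-- If the counting functions are comparable, the one set is transformed into the other by
rectangle moves whose total area is the sum of the absolute differences. -/
theorem rectChain_of_sign (K : Finset Pt) {S T : Finset Pt} (hS : BiInj S) (hT : BiInj T)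
    (hST : SameLines S T)
    (hle : (∀ p, 0 ≤ cnt S p - cnt T p) ∨ ∀ p, cnt S p - cnt T p ≤ 0)
    (hK : ∀ p, p ∉ K → cnt S p - cnt T p = 0) :
    RectChain S T (∑ p ∈ K, |cnt S p - cnt T p|) := by
  rcases hle with hle | hle
  · rw [Finset.sum_congr rfl fun p _ => abs_of_nonneg (hle p)]
    exact rectChain_of_cnt_le K hS hT hST (fun p => by have := hle p; omega)
      fun p hp => by have := hK p hp; omega
  · rw [Finset.sum_congr rfl fun p _ => (abs_of_nonpos (hle p)).trans (neg_sub _ _)]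
    exact (rectChain_of_cnt_le K hT hS hST.symm (fun p => by have := hle p; omega)
      fun p hp => by have := hK p hp; omega).reverse hT

/-! ### The rotation number as a function on unit squares -/

namespace LatticePolytope

theorem biInj_ver0 (P : LatticePolytope) : BiInj P.ver0 := fun _ hp _ hq =>
  ⟨fun h => P.inj_x0 hp hq h, fun h => P.inj_y0 hp hq h⟩

theorem biInj_ver1 (P : LatticePolytope) : BiInj P.ver1 := fun _ hp _ hq =>
  ⟨fun h => P.inj_x1 hp hq h, fun h => P.inj_y1 hp hq h⟩

theorem sameLines (P : LatticePolytope) : SameLines P.ver0 P.ver1 := ⟨P.same_x, P.same_y⟩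

/-- The rotation number of `P` around the points of the unit square with lower left corner `p`. -/
def faceRot (P : LatticePolytope) (p : Pt) : ℤ := cnt P.ver0 p - cnt P.ver1 p

theorem mem_edgesX {P : LatticePolytope} {e : Pt × Pt} :
    e ∈ P.edgesX ↔ (e.1 ∈ P.ver0 ∧ e.2 ∈ P.ver1) ∧ e.1.2 = e.2.2 ∧ e.1 ≠ e.2 := by
  simp [edgesX]

theorem mem_edgesY {P : LatticePolytope} {e : Pt × Pt} :
    e ∈ P.edgesY ↔ (e.1 ∈ P.ver1 ∧ e.2 ∈ P.ver0) ∧ e.1.1 = e.2.1 ∧ e.1 ≠ e.2 := by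
  simp [edgesY]

theorem disjoint_edges (P : LatticePolytope) : Disjoint P.edgesX P.edgesY := by
  rw [Finset.disjoint_left]
  intro e h1 h2
  rw [mem_edgesX] at h1
  rw [mem_edgesY] at h2
  exact h1.2.2 (Prod.ext h2.2.1 h1.2.1)

end LatticePolytope

theorem BiInj.sum_snd {S T : Finset Pt} (hS : BiInj S) (hT : BiInj T) (h : SameLines S T)
    (g : ℤ → ℤ) : ∑ x ∈ S, g x.2 = ∑ x ∈ T, g x.2 := by
  have key : ∀ {U : Finset Pt}, BiInj U → ∑ x ∈ U, g x.2 = ∑ y ∈ U.image Prod.snd, g y :=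
    fun hU => (Finset.sum_image fun p hp q hq e => (hU p hp q hq).2 e).symm
  rw [key hS, key hT, h.2]

theorem BiInj.sum_fst {S T : Finset Pt} (hS : BiInj S) (hT : BiInj T) (h : SameLines S T)
    (g : ℤ → ℤ) : ∑ x ∈ S, g x.1 = ∑ x ∈ T, g x.1 := by
  have key : ∀ {U : Finset Pt}, BiInj U → ∑ x ∈ U, g x.1 = ∑ y ∈ U.image Prod.fst, g y :=
    fun hU => (Finset.sum_image fun p hp q hq e => (hU p hp q hq).1 e).symm
  rw [key hS, key hT, h.1]

theorem rayCross_eq_floor (e : Pt × Pt) (q : ℝ × ℝ) :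
    rayCross e q = if ⌊q.1⌋ < e.1.1 ∧ e.1.2 ≤ ⌊q.2⌋ ∧ ⌊q.2⌋ < e.2.2 then 1
      else if ⌊q.1⌋ < e.1.1 ∧ e.2.2 ≤ ⌊q.2⌋ ∧ ⌊q.2⌋ < e.1.2 then -1 else 0 := by
  simp only [rayCross, Int.floor_lt, Int.le_floor]

theorem rayCross_vertical {u s : Pt} (h : u.1 = s.1) (q : ℝ × ℝ) :
    rayCross (u, s) q =
      ((if u.2 ≤ ⌊q.2⌋ then 1 else 0) - quad u (⌊q.1⌋, ⌊q.2⌋)) -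
        ((if s.2 ≤ ⌊q.2⌋ then 1 else 0) - quad s (⌊q.1⌋, ⌊q.2⌋)) := by
  rw [rayCross_eq_floor]
  simp only [quad, h]
  split_ifs <;> omega

theorem rayCross_horizontal {e : Pt × Pt} (h : e.1.2 = e.2.2) (q : ℝ × ℝ) : rayCross e q = 0 := by
  rw [rayCross_eq_floor]
  split_ifs <;> omega

namespace LatticePolytope

/-- Only vertical edges cross the ray, and such an edge contributes `h u - h s`, where `h` indicates
the points that lie to the right of the square and not above its lower side. Every column contains
one initial and one terminal vertex, so the sum over edges becomes a difference of sums over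
vertices. The height terms cancel because both vertex sets occupy the same rows. -/
theorem rot_eq_faceRot (P : LatticePolytope) (q : ℝ × ℝ) :
    P.rot q = P.faceRot (⌊q.1⌋, ⌊q.2⌋) := by
  set i := ⌊q.1⌋
  set j := ⌊q.2⌋
  set h : Pt → ℤ := fun z => (if z.2 ≤ j then 1 else 0) - quad z (i, j) with hh
  have hX : ∑ e ∈ P.edgesX, rayCross e q = 0 :=
    Finset.sum_eq_zero fun e he => rayCross_horizontal (mem_edgesX.1 he).2.1 q
  have hY : ∑ e ∈ P.edgesY, rayCross e q =
      ∑ u ∈ P.ver1, ∑ s ∈ P.ver0, if u.1 = s.1 then h u - h s else 0 := by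
    rw [edgesY, Finset.sum_filter, Finset.sum_product]
    refine Finset.sum_congr rfl fun u _ => Finset.sum_congr rfl fun s _ => ?_
    by_cases hus : u.1 = s.1
    · rw [if_pos hus]
      by_cases he : u = s
      · simp [he]
      · rw [if_pos ⟨hus, he⟩, rayCross_vertical hus]
    · rw [if_neg hus, if_neg fun h => hus h.1]
  have h1 : ∑ u ∈ P.ver1, ∑ s ∈ P.ver0, (if u.1 = s.1 then h u else 0) = ∑ u ∈ P.ver1, h u := by
    refine Finset.sum_congr rfl fun u hu => ?_
    obtain ⟨s, hs, hsu⟩ := P.sameLines.symm.exists_fst hu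
    rw [Finset.sum_eq_single_of_mem s hs, if_pos hsu.symm]
    intro t ht hts
    exact if_neg fun e => hts ((P.biInj_ver0 t ht s hs).1 (e.symm.trans hsu.symm))
  have h2 : ∑ u ∈ P.ver1, ∑ s ∈ P.ver0, (if u.1 = s.1 then h s else 0) = ∑ s ∈ P.ver0, h s := by
    rw [Finset.sum_comm]
    refine Finset.sum_congr rfl fun s hs => ?_
    obtain ⟨u, hu, hus⟩ := P.sameLines.exists_fst hs
    rw [Finset.sum_eq_single_of_mem u hu, if_pos hus]
    intro t ht htu
    exact if_neg fun e => htu ((P.biInj_ver1 t ht u hu).1 (e.trans hus.symm))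
  have h3 := P.biInj_ver0.sum_snd P.biInj_ver1 P.sameLines fun y => if y ≤ j then 1 else 0
  have h4 : ∑ u ∈ P.ver1, ∑ s ∈ P.ver0, (if u.1 = s.1 then h u - h s else 0) =
      ∑ u ∈ P.ver1, h u - ∑ s ∈ P.ver0, h s := by
    rw [← h1, ← h2, ← Finset.sum_sub_distrib]
    refine Finset.sum_congr rfl fun u _ => ?_
    rw [← Finset.sum_sub_distrib]
    refine Finset.sum_congr rfl fun s _ => ?_
    split_ifs <;> simp
  rw [rot, edges, Finset.sum_union P.disjoint_edges, hX, hY, h4, faceRot, cnt, cnt]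
  simp only [hh, Finset.sum_sub_distrib]
  linarith

theorem notMem_boundary (P : LatticePolytope) {q : ℝ × ℝ}
    (h1 : ∀ n : ℤ, q.1 ≠ n) (h2 : ∀ n : ℤ, q.2 ≠ n) : q ∉ P.boundary := by
  intro hq
  simp only [boundary, Set.mem_iUnion] at hq
  obtain ⟨e, he, a, b, -, -, hab, rfl⟩ := hq
  rcases Finset.mem_union.1 he with he | he
  · apply h2 e.1.2
    have := (mem_edgesX.1 he).2.1
    simp only [toPlane, Prod.snd_add, Prod.smul_snd, smul_eq_mul, ← this, ← add_mul, hab, one_mul]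
  · apply h1 e.1.1
    have := (mem_edgesY.1 he).2.1
    simp only [toPlane, Prod.fst_add, Prod.smul_fst, smul_eq_mul, ← this, ← add_mul, hab, one_mul]

/-- The corner is the limit of points on the segment from it to the centre of the square; these are
off the boundary because both coordinates are non-integral. -/
theorem corner_mem_carrier (P : LatticePolytope) {p x : Pt} (hp : P.faceRot p ≠ 0)
    (h1 : x.1 = p.1 ∨ x.1 = p.1 + 1) (h2 : x.2 = p.2 ∨ x.2 = p.2 + 1) :
    toPlane x ∈ P.carrier := by
  refine Or.inl (Or.inl ?_)
  set f : ℝ → ℝ × ℝ := fun t =>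
    ((x.1 : ℝ) + t * (p.1 + 1 / 2 - x.1), (x.2 : ℝ) + t * (p.2 + 1 / 2 - x.2)) with hf
  have hcont : Continuous f := by fun_prop
  have hlim : Filter.Tendsto f (nhdsWithin 0 (Set.Ioi 0)) (nhds (toPlane x)) := by
    have := (hcont.tendsto 0).mono_left (nhdsWithin_le_nhds (s := Set.Ioi 0))
    simpa [hf, toPlane] using this
  refine mem_closure_of_tendsto hlim ?_
  filter_upwards [Ioo_mem_nhdsGT (zero_lt_one (α := ℝ))] with t ht
  obtain ⟨ht0, ht1⟩ := ht
  have aux : ∀ m n : ℤ, (m = n ∨ m = n + 1) →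
      (n : ℝ) < m + t * (n + 1 / 2 - m) ∧ (m : ℝ) + t * (n + 1 / 2 - m) < n + 1 := by
    intro m n h
    rcases h with rfl | rfl
    · constructor <;> nlinarith
    · push_cast
      constructor <;> nlinarith
  have nonint : ∀ (r : ℝ) (n : ℤ), (n : ℝ) < r ∧ r < n + 1 → ∀ k : ℤ, r ≠ k := by
    rintro r n ⟨h, h'⟩ k rfl
    have : n < k := by exact_mod_cast h
    have : k < n + 1 := by exact_mod_cast h'
    omega
  have e1 := aux _ _ h1
  have e2 := aux _ _ h2
  refine ⟨P.notMem_boundary (nonint _ _ e1) (nonint _ _ e2), ?_⟩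
  rw [rot_eq_faceRot]
  have f1 : ⌊(f t).1⌋ = p.1 := Int.floor_eq_iff.2 ⟨e1.1.le, e1.2⟩
  have f2 : ⌊(f t).2⌋ = p.2 := Int.floor_eq_iff.2 ⟨e2.1.le, e2.2⟩
  rwa [f1, f2]

end LatticePolytope

theorem mem_mirrorSet {S : Finset Pt} {x : Pt} : x ∈ mirrorSet S ↔ x.swap ∈ S := by
  simp only [mirrorSet, Finset.mem_image]
  constructor
  · rintro ⟨y, hy, rfl⟩
    simpa using hy
  · exact fun h => ⟨x.swap, h, Prod.swap_swap x⟩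

theorem cnt_mirrorSet (S : Finset Pt) (p : Pt) : cnt (mirrorSet S) p = cnt S p.swap := by
  rw [cnt, mirrorSet, Finset.sum_image fun a _ b _ h => Prod.swap_injective h, cnt]
  refine Finset.sum_congr rfl fun x _ => ?_
  simp [quad, and_comm]

theorem cnt_union {S T : Finset Pt} (h : Disjoint S T) (p : Pt) :
    cnt (S ∪ T) p = cnt S p + cnt T p :=
  Finset.sum_union h

theorem LatticePolytope.faceRot_negMirror (P : LatticePolytope) (p : Pt) :
    P.negMirror.faceRot p = P.faceRot p.swap := by
  simp only [LatticePolytope.faceRot, LatticePolytope.negMirror, cnt_mirrorSet]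

/-- Counting functions of sets that occupy the same lines agree outside a box. -/
theorem exists_support {S T : Finset Pt} (hS : BiInj S) (hT : BiInj T) (h : SameLines S T) :
    ∃ N : ℤ, ∀ p : Pt, (p.1 < -N ∨ N ≤ p.1 ∨ p.2 < -N ∨ N ≤ p.2) → cnt S p = cnt T p := by
  obtain ⟨N, hN⟩ : ∃ N : ℤ, ∀ x ∈ S ∪ T, |x.1| ≤ N ∧ |x.2| ≤ N := by
    refine ⟨∑ x ∈ S ∪ T, (|x.1| + |x.2|), fun x hx => ?_⟩
    have : |x.1| + |x.2| ≤ ∑ x ∈ S ∪ T, (|x.1| + |x.2|) :=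
      Finset.single_le_sum (f := fun x : Pt => |x.1| + |x.2|) (fun x _ => by positivity) hx
    have := abs_nonneg x.1
    have := abs_nonneg x.2
    constructor <;> linarith
  have bd : ∀ x ∈ S ∪ T, -N ≤ x.1 ∧ x.1 ≤ N ∧ -N ≤ x.2 ∧ x.2 ≤ N := fun x hx =>
    ⟨(abs_le.1 (hN x hx).1).1, (abs_le.1 (hN x hx).1).2, (abs_le.1 (hN x hx).2).1,
      (abs_le.1 (hN x hx).2).2⟩
  have bS : ∀ x ∈ S, _ := fun x hx => bd x (Finset.mem_union_left _ hx)
  have bT : ∀ x ∈ T, _ := fun x hx => bd x (Finset.mem_union_right _ hx)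
  refine ⟨N, fun p hp => ?_⟩
  rcases hp with hp | hp | hp | hp
  · rw [cnt, cnt, Finset.sum_eq_zero, Finset.sum_eq_zero] <;> intro x hx <;>
      [have := bT x hx; have := bS x hx] <;> simp only [quad] <;> split_ifs <;> omega
  -- Far to the right the condition on the first coordinate always holds, so only the rows count,
  -- and these agree for the two sets.
  · rw [cnt, cnt]
    convert hS.sum_snd hT h fun y => if y ≤ p.2 then 1 else 0 using 1 <;>
      refine Finset.sum_congr rfl fun x hx => ?_ <;>
      [have := bS x hx; have := bT x hx] <;> simp only [quad] <;> split_ifs <;> omega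
  · rw [cnt, cnt, Finset.sum_eq_zero, Finset.sum_eq_zero] <;> intro x hx <;>
      [have := bT x hx; have := bS x hx] <;> simp only [quad] <;> split_ifs <;> omega
  · rw [cnt, cnt]
    convert hS.sum_fst hT h fun y => if y ≤ p.1 then 1 else 0 using 1 <;>
      refine Finset.sum_congr rfl fun x hx => ?_ <;>
      [have := bS x hx; have := bT x hx] <;> simp only [quad] <;> split_ifs <;> omega

theorem LatticePolytope.exists_box (P : LatticePolytope) :
    ∃ N : ℤ, ∀ p : Pt, (p.1 < -N ∨ N ≤ p.1 ∨ p.2 < -N ∨ N ≤ p.2) → P.faceRot p = 0 := by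
  obtain ⟨N, hN⟩ := exists_support P.biInj_ver0 P.biInj_ver1 P.sameLines
  exact ⟨N, fun p hp => sub_eq_zero.2 (hN p hp)⟩

theorem LatticePolytope.finite_support (P : LatticePolytope) :
    (Function.support P.faceRot).Finite := by
  obtain ⟨N, hN⟩ := P.exists_box
  refine (Finset.finite_toSet (Finset.Ico (-N) N ×ˢ Finset.Ico (-N) N)).subset fun p hp => ?_
  by_contra hcon
  refine hp (hN p ?_)
  simp only [Finset.coe_product, Set.mem_prod, Finset.coe_Ico, Set.mem_Ico] at hcon
  omega

/-- The unit squares with nonzero rotation number. -/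
def LatticePolytope.faces (P : LatticePolytope) : Finset Pt := P.finite_support.toFinset

theorem LatticePolytope.mem_faces {P : LatticePolytope} {p : Pt} :
    p ∈ P.faces ↔ P.faceRot p ≠ 0 := by
  simp [LatticePolytope.faces]

/-- `Area|P|` as an integer. -/
def LatticePolytope.faceArea (P : LatticePolytope) : ℤ := ∑ p ∈ P.faces, |P.faceRot p|

theorem LatticePolytope.sum_abs_faceRot (P : LatticePolytope) {K : Finset Pt}
    (hK : P.faces ⊆ K) : ∑ p ∈ K, |P.faceRot p| = P.faceArea :=
  (Finset.sum_subset hK fun p _ hp => by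
    simpa [LatticePolytope.mem_faces] using hp).symm

theorem LatticePolytope.absArea_eq (P : LatticePolytope) : P.absArea = (P.faceArea : ℝ) := by
  have hsum : (fun q : ℝ × ℝ => |(P.rot q : ℝ)|) = fun q => ∑ p ∈ P.faces,
      (Set.Ico (p.1 : ℝ) (p.1 + 1) ×ˢ Set.Ico (p.2 : ℝ) (p.2 + 1)).indicator
        (fun _ => |(P.faceRot p : ℝ)|) q := by
    funext q
    -- The half-open squares partition the plane, so exactly one index survives and the identity
    -- holds at every point, also on the grid lines.
    have hmem : ∀ p : Pt, q ∈ Set.Ico (p.1 : ℝ) (p.1 + 1) ×ˢ Set.Ico (p.2 : ℝ) (p.2 + 1) ↔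
        p = (⌊q.1⌋, ⌊q.2⌋) := by
      intro p
      rw [Prod.ext_iff, eq_comm, @eq_comm _ p.2, Int.floor_eq_iff, Int.floor_eq_iff]
      rfl
    rw [P.rot_eq_faceRot]
    by_cases h0 : P.faceRot (⌊q.1⌋, ⌊q.2⌋) = 0
    · rw [h0, Finset.sum_eq_zero]
      · simp
      · intro p hp
        refine Set.indicator_of_notMem (fun h => ?_) _
        rw [hmem] at h
        exact LatticePolytope.mem_faces.1 hp (h ▸ h0)
    · rw [Finset.sum_eq_single_of_mem _ (LatticePolytope.mem_faces.2 h0)]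
      · rw [Set.indicator_of_mem ((hmem _).2 rfl)]
      · intro p _ hp
        exact Set.indicator_of_notMem (fun h => hp ((hmem p).1 h)) _
  have hvol : ∀ p : Pt, MeasureTheory.volume
      (Set.Ico (p.1 : ℝ) (p.1 + 1) ×ˢ Set.Ico (p.2 : ℝ) (p.2 + 1)) = 1 := by
    intro p
    rw [MeasureTheory.Measure.volume_eq_prod, MeasureTheory.Measure.prod_prod]
    simp
  have hms : ∀ p : Pt, MeasurableSet
      (Set.Ico (p.1 : ℝ) (p.1 + 1) ×ˢ Set.Ico (p.2 : ℝ) (p.2 + 1)) :=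
    fun p => measurableSet_Ico.prod measurableSet_Ico
  rw [LatticePolytope.absArea, hsum, MeasureTheory.integral_finsetSum, faceArea]
  · push_cast
    refine Finset.sum_congr rfl fun p _ => ?_
    rw [MeasureTheory.integral_indicator_const _ (hms p), MeasureTheory.measureReal_def, hvol]
    simp
  · intro p _
    refine (MeasureTheory.integrable_indicator_iff (hms p)).2 ?_
    exact MeasureTheory.integrableOn_const (by rw [hvol]; simp)

/-! ### Symmetric moves of lattice presentations -/

theorem IsLatticePresentation.biInj {S : Finset Pt} (hS : IsLatticePresentation S) : BiInj S := by
  intro p hp q hq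
  refine ⟨fun h => hS.degree_le_one hp hq h, fun h => ?_⟩
  exact Prod.swap_injective (hS.degree_le_one (hS.symm p hp) (hS.symm q hq) h)

/-- The coordinates of two points that present distinct arcs are distinct. -/
theorem IsLatticePresentation.coord_ne {S : Finset Pt} (hS : IsLatticePresentation S) {v w : Pt}
    (hv : v ∈ S) (hw : w ∈ S) (h : w ≠ v) (h' : w ≠ v.swap) :
    v.1 ≠ v.2 ∧ w.1 ≠ w.2 ∧ v.1 ≠ w.1 ∧ v.2 ≠ w.2 ∧ v.1 ≠ w.2 ∧ v.2 ≠ w.1 :=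
  ⟨hS.off_diag v hv, hS.off_diag w hw, hS.biInj.fst_ne hv hw h.symm, hS.biInj.snd_ne hv hw h.symm,
    fun e => h' ((hS.biInj w hw _ (hS.symm v hv)).2 e.symm),
    fun e => h' ((hS.biInj w hw _ (hS.symm v hv)).1 e.symm)⟩

/-- The inequalities say that the four ends of the two arcs are distinct, so the mirrored rectangle
touches none of the points created by the first one. -/
theorem mem_symMove {S : Finset Pt} {v w x : Pt}
    (h : v.1 ≠ v.2 ∧ w.1 ≠ w.2 ∧ v.1 ≠ w.1 ∧ v.2 ≠ w.2 ∧ v.1 ≠ w.2 ∧ v.2 ≠ w.1) :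
    x ∈ symMove S v w ↔ (x ∈ S ∧ x ≠ v ∧ x ≠ w ∧ x ≠ v.swap ∧ x ≠ w.swap) ∨
      x = (w.1, v.2) ∨ x = (v.1, w.2) ∨ x = (w.2, v.1) ∨ x = (v.2, w.1) := by
  obtain ⟨x1, x2⟩ := x
  obtain ⟨a, b⟩ := v
  obtain ⟨c, d⟩ := w
  simp only [symMove, mem_rectMove, Prod.swap_prod_mk, Prod.mk.injEq, ne_eq] at h ⊢
  constructor
  · rintro (⟨h1 | h1, h2⟩ | h1)
    · exact Or.inl ⟨h1.1, h1.2.1, h1.2.2, h2.1, h2.2⟩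
    · exact Or.inr (h1.elim Or.inl (Or.inr ∘ Or.inl))
    · exact Or.inr (Or.inr (Or.inr h1))
  · rintro (h1 | h1 | h1 | h1 | h1)
    · exact Or.inl ⟨Or.inl ⟨h1.1, h1.2.1, h1.2.2.1⟩, h1.2.2.2⟩
    · exact Or.inl ⟨Or.inr (Or.inl h1), by omega, by omega⟩
    · exact Or.inl ⟨Or.inr (Or.inr h1), by omega, by omega⟩
    · exact Or.inr (Or.inl h1)
    · exact Or.inr (Or.inr h1)

theorem IsLatticePresentation.symMove {S : Finset Pt} (hS : IsLatticePresentation S) {v w : Pt}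
    (hv : v ∈ S) (hw : w ∈ S) (h : w ≠ v) (h' : w ≠ v.swap) :
    IsLatticePresentation (symMove S v w) := by
  have hc := hS.coord_ne hv hw h h'
  have hv' := hS.symm v hv
  have hw' := hS.symm w hw
  have hs : ∀ a b : Pt, a.swap ≠ b.swap ↔ a ≠ b := fun a b => Prod.swap_injective.ne_iff
  have hB : BiInj (PartialMatching.symMove S v w) := by
    refine (hS.biInj.rectMove hv hw h.symm).rectMove (mem_rectMove.2 (Or.inl ⟨hv', ?_, h'.symm⟩))
      (mem_rectMove.2 (Or.inl ⟨hw', ?_, ?_⟩)) ((hs _ _).2 h.symm)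
    · exact fun e => hc.1 (congrArg Prod.snd e)
    · exact fun e => hc.2.2.2.2.1 (congrArg Prod.fst e).symm
    · exact fun e => hc.2.1 (congrArg Prod.snd e)
  refine ⟨?_, ?_, ?_, fun p hp q hq e => (hB p hp q hq).1 e⟩
  · intro x hx
    have := hS.pos v hv
    have := hS.pos w hw
    rcases (mem_symMove hc).1 hx with hx | rfl | rfl | rfl | rfl
    · exact hS.pos x hx.1
    all_goals constructor <;> simp only <;> omega
  · intro x hx
    rcases (mem_symMove hc).1 hx with hx | rfl | rfl | rfl | rfl
    · exact hS.off_diag x hx.1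
    all_goals simp only; omega
  · intro x hx
    rw [mem_symMove hc] at hx ⊢
    rcases hx with hx | rfl | rfl | rfl | rfl
    · refine Or.inl ⟨hS.symm x hx.1, ?_, ?_, (hs _ _).2 hx.2.1, (hs _ _).2 hx.2.2.1⟩
      · exact fun e => hx.2.2.2.1 (by rw [← e, Prod.swap_swap])
      · exact fun e => hx.2.2.2.2 (by rw [← e, Prod.swap_swap])
    all_goals simp

theorem IsLatticePresentation.abs_cnt_symMove_le {S : Finset Pt} (hS : IsLatticePresentation S)
    {v w : Pt} (hv : v ∈ S) (hw : w ∈ S) (h : w ≠ v) (h' : w ≠ v.swap) (p : Pt) :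
    |cnt S p - cnt (PartialMatching.symMove S v w) p| ≤
      (if p ∈ rectFaces v w then 1 else 0) + (if p ∈ rectFaces v.swap w.swap then 1 else 0) := by
  have hc := hS.coord_ne hv hw h h'
  have hv' := hS.symm v hv
  have hw' := hS.symm w hw
  have e := cnt_rectMove (hS.biInj.rectMove hv hw h.symm)
    (mem_rectMove.2 (Or.inl ⟨hv', fun e => hc.1 (congrArg Prod.snd e), h'.symm⟩))
    (mem_rectMove.2 (Or.inl ⟨hw', fun e => hc.2.2.2.2.1 (congrArg Prod.fst e).symm,
      fun e => hc.2.1 (congrArg Prod.snd e)⟩))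
    (fun e => h.symm (Prod.swap_injective e)) p
  have e' := cnt_rectMove hS.biInj hv hw h.symm p
  rw [PartialMatching.symMove, e, e', ← abs_quad_rect, ← abs_quad_rect]
  refine le_trans (le_of_eq ?_) (abs_add_le _ _)
  congr 1
  ring

namespace Transformation

variable {Δ Δ' : Finset Pt}

theorem isLatticePresentation_stage (T : Transformation Δ Δ') (hΔ : IsLatticePresentation Δ) :
    ∀ j ≤ T.len, IsLatticePresentation (T.stage j) := by
  intro j
  induction j with
  | zero =>
    intro _
    rwa [T.stage_zero]
  | succ j ih =>
    intro hj
    have hlt : j < T.len := hj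
    rw [T.stage_succ j hlt]
    exact (ih hlt.le).symMove (T.v_mem j hlt) (T.w_mem j hlt) (T.ne j hlt) (T.ne_swap j hlt)

theorem abs_cnt_sub_le (T : Transformation Δ Δ') (hΔ : IsLatticePresentation Δ) (p : Pt) :
    |cnt Δ p - cnt Δ' p| ≤ ∑ j ∈ Finset.range T.len,
      ((if p ∈ rectFaces (T.v j) (T.w j) then 1 else 0) +
        (if p ∈ rectFaces (T.v j).swap (T.w j).swap then 1 else 0) : ℤ) := by
  have h : cnt Δ p - cnt Δ' p =
      ∑ j ∈ Finset.range T.len, (cnt (T.stage j) p - cnt (T.stage (j + 1)) p) := by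
    rw [Finset.sum_range_sub', T.stage_zero, T.stage_len]
  rw [h]
  refine (Finset.abs_sum_le_sum_abs _ _).trans (Finset.sum_le_sum fun j hj => ?_)
  have hlt := Finset.mem_range.1 hj
  rw [T.stage_succ j hlt]
  exact (T.isLatticePresentation_stage hΔ j hlt.le).abs_cnt_symMove_le (T.v_mem j hlt)
    (T.w_mem j hlt) (T.ne j hlt) (T.ne_swap j hlt) p

end Transformation

/-! ### Area bound and the case of equality -/

namespace LatticePolytope.IsAssociated

variable {Δ Δ' : Finset Pt} {P : LatticePolytope}

theorem cnt_sub (hP : P.IsAssociated Δ Δ') (p : Pt) :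
    cnt Δ p - cnt Δ' p = P.faceRot p + P.faceRot p.swap := by
  rw [← hP.union0, ← hP.union1, cnt_union hP.disjoint0, cnt_union hP.disjoint1,
    ← P.faceRot_negMirror]
  simp only [faceRot]
  ring

end LatticePolytope.IsAssociated

theorem LatticePolytope.DisjointFromMirror.notMem {P : LatticePolytope}
    (hd : P.DisjointFromMirror) {q : ℝ × ℝ} (h : q ∈ P.carrier) : q ∉ P.negMirror.carrier :=
  Set.disjoint_left.1 hd h

/-- A square of `P` and a square of `-P^*` have no common corner. -/
theorem LatticePolytope.DisjointFromMirror.no_common_corner {P : LatticePolytope}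
    (hd : P.DisjointFromMirror) {p q x : Pt} (hp : P.faceRot p ≠ 0) (hq : P.faceRot q.swap ≠ 0)
    (h1 : x.1 = p.1 ∨ x.1 = p.1 + 1) (h2 : x.2 = p.2 ∨ x.2 = p.2 + 1)
    (h3 : x.1 = q.1 ∨ x.1 = q.1 + 1) (h4 : x.2 = q.2 ∨ x.2 = q.2 + 1) : False := by
  rw [← P.faceRot_negMirror] at hq
  exact hd.notMem (P.corner_mem_carrier hp h1 h2) (P.negMirror.corner_mem_carrier hq h3 h4)

theorem rectFaces_swap {v w p : Pt} : p ∈ rectFaces v.swap w.swap ↔ p.swap ∈ rectFaces v w := by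
  simp only [mem_rectFaces, Prod.fst_swap, Prod.snd_swap]
  tauto

/-- Double counting: `r p` is the number of rectangles covering the square `p`, and it is at least
|cnt Δ - cnt Δ'|. The assumption on the area forces equality in the sum over `K`, hence on each
square, so a covered square has nonzero rotation number in P or in -P^*. -/
theorem Transformation.rectFaces_subset {Δ Δ' : Finset Pt} (T : Transformation Δ Δ')
    (hΔ : IsLatticePresentation Δ) {P : LatticePolytope} (hP : P.IsAssociated Δ Δ')
    (hd : P.DisjointFromMirror) (harea : T.area ≤ P.faceArea) {j : ℕ} (hj : j < T.len) {p : Pt}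
    (hp : p ∈ rectFaces (T.v j) (T.w j)) : P.faceRot p ≠ 0 ∨ P.faceRot p.swap ≠ 0 := by
  set K : Finset Pt := P.faces ∪ P.negMirror.faces ∪ (Finset.range T.len).biUnion fun j =>
    rectFaces (T.v j) (T.w j) ∪ rectFaces (T.v j).swap (T.w j).swap with hK
  set r : Pt → ℤ := fun p => ∑ j ∈ Finset.range T.len,
      ((if p ∈ rectFaces (T.v j) (T.w j) then 1 else 0) +
        (if p ∈ rectFaces (T.v j).swap (T.w j).swap then 1 else 0) : ℤ) with hr
  have habs : ∀ p, |cnt Δ p - cnt Δ' p| = |P.faceRot p| + |P.negMirror.faceRot p| := by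
    intro p
    rw [hP.cnt_sub, P.faceRot_negMirror]
    by_cases h : P.faceRot p = 0
    · simp [h]
    · have : P.faceRot p.swap = 0 := by
        by_contra h'
        exact hd.no_common_corner h h' (Or.inl rfl) (Or.inl rfl) (Or.inl rfl) (Or.inl rfl)
      simp [this]
  have hneg : P.negMirror.faceArea = P.faceArea := by
    unfold LatticePolytope.faceArea
    refine Finset.sum_bij' (fun p _ => p.swap) (fun p _ => p.swap) ?_ ?_ ?_ ?_ ?_ <;> intro p hp <;>
      simp_all [LatticePolytope.mem_faces, LatticePolytope.faceRot_negMirror]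
  have hsum1 : ∑ p ∈ K, |cnt Δ p - cnt Δ' p| = 2 * P.faceArea := by
    rw [Finset.sum_congr rfl fun p _ => habs p, Finset.sum_add_distrib, P.sum_abs_faceRot,
      P.negMirror.sum_abs_faceRot, hneg]
    · ring
    · exact fun x hx => Finset.mem_union_left _ (Finset.mem_union_right _ hx)
    · exact fun x hx => Finset.mem_union_left _ (Finset.mem_union_left _ hx)
  -- The factor 2 arises because `r` counts each rectangle together with its mirror image, whereas
  -- the area of `T` counts only one of them.
  have hsum2 : ∑ p ∈ K, r p ≤ 2 * T.area := by
    have hcard : ∀ R : Finset Pt, ∑ p ∈ K, (if p ∈ R then 1 else 0 : ℤ) ≤ R.card := by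
      intro R
      rw [← Finset.sum_filter, Finset.filter_mem_eq_inter, Finset.sum_const, nsmul_one]
      exact_mod_cast Finset.card_le_card Finset.inter_subset_right
    rw [hr, Finset.sum_comm, Transformation.area, Finset.mul_sum]
    refine Finset.sum_le_sum fun j _ => ?_
    rw [Finset.sum_add_distrib]
    have h1 := hcard (rectFaces (T.v j) (T.w j))
    have h2 := hcard (rectFaces (T.v j).swap (T.w j).swap)
    rw [card_rectFaces] at h1 h2
    simp only [Prod.fst_swap, Prod.snd_swap] at h2
    linarith
  have hle : ∀ p ∈ K, |cnt Δ p - cnt Δ' p| ≤ r p := fun p _ => T.abs_cnt_sub_le hΔ p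
  have heq : ∑ p ∈ K, |cnt Δ p - cnt Δ' p| = ∑ p ∈ K, r p :=
    le_antisymm (Finset.sum_le_sum hle) (by linarith)
  have hpK : p ∈ K := Finset.mem_union_right _
    (Finset.mem_biUnion.2 ⟨j, Finset.mem_range.2 hj, Finset.mem_union_left _ hp⟩)
  have hpt := (Finset.sum_eq_sum_iff_of_le hle).1 heq p hpK
  have hpos : 0 < r p := by
    refine Finset.sum_pos' (fun i _ => by split_ifs <;> norm_num)
      ⟨j, Finset.mem_range.2 hj, ?_⟩
    rw [if_pos hp]
    split_ifs <;> norm_num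
  rw [habs, P.faceRot_negMirror] at hpt
  by_contra hcon
  rw [not_or, not_not, not_not] at hcon
  rw [hcon.1, hcon.2] at hpt
  simp at hpt
  omega

/-- A rectangle covered by two families of unit squares without common corners lies in one
of them. -/
theorem rectFaces_connected {A B : Pt → Prop}
    (hAB : ∀ p q x : Pt, A p → B q → (x.1 = p.1 ∨ x.1 = p.1 + 1) → (x.2 = p.2 ∨ x.2 = p.2 + 1) →
      (x.1 = q.1 ∨ x.1 = q.1 + 1) → (x.2 = q.2 ∨ x.2 = q.2 + 1) → False)
    {v w : Pt} (h : ∀ p ∈ rectFaces v w, A p ∨ B p) {p q : Pt} (hp : p ∈ rectFaces v w)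
    (hq : q ∈ rectFaces v w) (hA : A p) : A q := by
  have base : ∀ a b : ℤ, (a, b) ∈ rectFaces v w → (A (a, b) ↔ A (min v.1 w.1, min v.2 w.2)) := by
    have right : ∀ a b : ℤ, (a, b) ∈ rectFaces v w → (a + 1, b) ∈ rectFaces v w →
        (A (a + 1, b) ↔ A (a, b)) := by
      intro a b h1 h2
      constructor <;> intro hA
      · refine (h _ h1).resolve_right fun hB => hAB _ _ (a + 1, b) hA hB ?_ ?_ ?_ ?_ <;> simp
      · refine (h _ h2).resolve_right fun hB => hAB _ _ (a + 1, b) hA hB ?_ ?_ ?_ ?_ <;> simp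
    have up : ∀ a b : ℤ, (a, b) ∈ rectFaces v w → (a, b + 1) ∈ rectFaces v w →
        (A (a, b + 1) ↔ A (a, b)) := by
      intro a b h1 h2
      constructor <;> intro hA
      · refine (h _ h1).resolve_right fun hB => hAB _ _ (a, b + 1) hA hB ?_ ?_ ?_ ?_ <;> simp
      · refine (h _ h2).resolve_right fun hB => hAB _ _ (a, b + 1) hA hB ?_ ?_ ?_ ?_ <;> simp
    have hcol : ∀ b, min v.2 w.2 ≤ b → (min v.1 w.1, b) ∈ rectFaces v w →
        (A (min v.1 w.1, b) ↔ A (min v.1 w.1, min v.2 w.2)) := by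
      intro b hb
      induction b, hb using Int.leInduction with
      | base => exact fun _ => Iff.rfl
      | succ b hb ih =>
        intro hm
        have hm' : (min v.1 w.1, b) ∈ rectFaces v w := by
          rw [mem_rectFaces] at hm ⊢
          simp only at hm ⊢
          omega
        rw [up _ _ hm' hm, ih hm']
    intro a b hab
    have ha := (mem_rectFaces.1 hab).1.1
    simp only at ha
    induction a, ha using Int.leInduction with
    | base => exact hcol b (mem_rectFaces.1 hab).2.1 hab
    | succ a ha ih =>
      have hm' : (a, b) ∈ rectFaces v w := by
        rw [mem_rectFaces] at hab ⊢
        simp only at hab ⊢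
        omega
      exact (right _ _ hm' hab).trans (ih hm')
  exact (base q.1 q.2 hq).2 ((base p.1 p.2 hp).1 hA)

/-- The corners of a rectangle are corners of its unit squares. -/
theorem LatticePolytope.rect_corner_mem_carrier {P : LatticePolytope} {v w x : Pt}
    (h1 : v.1 ≠ w.1) (h2 : v.2 ≠ w.2) (h : ∀ p ∈ rectFaces v w, P.faceRot p ≠ 0)
    (hx1 : x.1 = v.1 ∨ x.1 = w.1) (hx2 : x.2 = v.2 ∨ x.2 = w.2) : toPlane x ∈ P.carrier := by
  have aux : ∀ a b t : ℤ, a ≠ b → (t = a ∨ t = b) →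
      ∃ s, (min a b ≤ s ∧ s < max a b) ∧ (t = s ∨ t = s + 1) := by
    intro a b t hab ht
    by_cases hm : t = min a b
    · exact ⟨t, by omega, Or.inl rfl⟩
    · exact ⟨t - 1, by omega, Or.inr (by omega)⟩
  obtain ⟨s, hs, hs'⟩ := aux _ _ _ h1 hx1
  obtain ⟨t, ht, ht'⟩ := aux _ _ _ h2 hx2
  exact P.corner_mem_carrier (h (s, t) (mem_rectFaces.2 ⟨hs, ht⟩)) hs' ht'

theorem Transformation.rect_in_part {Δ Δ' : Finset Pt} (T : Transformation Δ Δ')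
    (hΔ : IsLatticePresentation Δ) {P : LatticePolytope} (hP : P.IsAssociated Δ Δ')
    (hd : P.DisjointFromMirror) (harea : T.area ≤ P.faceArea) {j : ℕ} (hj : j < T.len) :
    (∀ p ∈ rectFaces (T.v j) (T.w j), P.faceRot p ≠ 0) ∨
      ∀ p ∈ rectFaces (T.v j).swap (T.w j).swap, P.faceRot p ≠ 0 := by
  have hcov := fun p hp => T.rectFaces_subset hΔ hP hd harea hj (p := p) hp
  by_cases hex : ∃ p ∈ rectFaces (T.v j) (T.w j), P.faceRot p ≠ 0
  · obtain ⟨p, hp, hA⟩ := hex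
    exact Or.inl fun q hq => rectFaces_connected
      (fun p q x h1 h2 => hd.no_common_corner (p := p) (q := q) h1 h2) hcov hp hq hA
  · push Not at hex
    refine Or.inr fun q hq => ?_
    rw [rectFaces_swap] at hq
    simpa [hex _ hq] using hcov _ hq

/-! ### Replaying a transformation inside P -/

/-- A sequence of states that satisfies an invariant, constructed step by step. -/
theorem exists_seq {α : Type*} (n : ℕ) (I : ℕ → α → Prop) (R : ℕ → α → α → Prop) (a : α)
    (h0 : I 0 a) (h : ∀ j < n, ∀ s, I j s → ∃ t, I (j + 1) t ∧ R j s t) :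
    ∃ f : ℕ → α, f 0 = a ∧ (∀ j ≤ n, I j (f j)) ∧ ∀ j < n, R j (f j) (f (j + 1)) := by
  classical
  let next : ℕ → α → α := fun j s => if hs : j < n ∧ I j s then (h j hs.1 s hs.2).choose else s
  have hnext : ∀ j (hj : j < n) s (_ : I j s), I (j + 1) (next j s) ∧ R j s (next j s) := by
    intro j hj s hs
    have : next j s = (h j hj s hs).choose := dif_pos ⟨hj, hs⟩
    rw [this]
    exact (h j hj s hs).choose_spec
  let f : ℕ → α := fun j => Nat.rec a next j
  have hI : ∀ j ≤ n, I j (f j) := by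
    intro j
    induction j with
    | zero => exact fun _ => h0
    | succ j ih => exact fun hj => (hnext j hj _ (ih (Nat.le_of_succ_le hj))).1
  exact ⟨f, rfl, hI, fun j hj => (hnext j hj _ (hI j hj.le)).2⟩

theorem LatticePolytope.ext_ver {P Q : LatticePolytope} (h0 : P.ver0 = Q.ver0)
    (h1 : P.ver1 = Q.ver1) : P = Q := by
  cases P
  cases Q
  cases h0
  cases h1
  rfl

/-- The lattice polytope `t(P, R(v, w))`. -/
def LatticePolytope.move (P : LatticePolytope) {v w : Pt} (hv : v ∈ P.ver0) (hw : w ∈ P.ver0)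
    (h : v ≠ w) : LatticePolytope where
  ver0 := rectMove P.ver0 v w
  ver1 := P.ver1
  inj_x0 := fun p hp q hq e => ((P.biInj_ver0.rectMove hv hw h) p hp q hq).1 e
  inj_y0 := fun p hp q hq e => ((P.biInj_ver0.rectMove hv hw h) p hp q hq).2 e
  inj_x1 := P.inj_x1
  inj_y1 := P.inj_y1
  same_x := (sameLines_rectMove hv hw).1.symm.trans P.same_x
  same_y := (sameLines_rectMove hv hw).2.symm.trans P.same_y

theorem symMove_union_mirrorSet {S : Finset Pt} {v w : Pt}
    (hc : v.1 ≠ v.2 ∧ w.1 ≠ w.2 ∧ v.1 ≠ w.1 ∧ v.2 ≠ w.2 ∧ v.1 ≠ w.2 ∧ v.2 ≠ w.1)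
    (hv : v.swap ∉ S) (hw : w.swap ∉ S) :
    symMove (S ∪ mirrorSet S) v w = rectMove S v w ∪ mirrorSet (rectMove S v w) := by
  have hs : ∀ a b : Pt, a.swap = b ↔ a = b.swap := fun a b => by
    rw [Prod.swap_eq_iff_eq_swap]
  ext x
  rw [mem_symMove hc]
  simp only [Finset.mem_union, mem_mirrorSet, mem_rectMove, hs, ne_eq, Prod.swap_prod_mk]
  constructor
  · rintro (⟨h | h, h1, h2, h3, h4⟩ | h | h | h | h)
    · exact Or.inl (Or.inl ⟨h, h1, h2⟩)
    · exact Or.inr (Or.inl ⟨h, h3, h4⟩)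
    · exact Or.inl (Or.inr (Or.inl h))
    · exact Or.inl (Or.inr (Or.inr h))
    · exact Or.inr (Or.inr (Or.inr h))
    · exact Or.inr (Or.inr (Or.inl h))
  · have e1 : x ∈ S → x ≠ v.swap := fun h e => hv (e ▸ h)
    have e2 : x ∈ S → x ≠ w.swap := fun h e => hw (e ▸ h)
    have e3 : x.swap ∈ S → x ≠ v := fun h e => hv (e ▸ h)
    have e4 : x.swap ∈ S → x ≠ w := fun h e => hw (e ▸ h)
    rintro ((h | h | h) | (h | h | h))
    · exact Or.inl ⟨Or.inl h.1, h.2.1, h.2.2, e1 h.1, e2 h.1⟩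
    · exact Or.inr (Or.inl h)
    · exact Or.inr (Or.inr (Or.inl h))
    · exact Or.inl ⟨Or.inr h.1, e3 h.1, e4 h.1, h.2.1, h.2.2⟩
    · exact Or.inr (Or.inr (Or.inr (Or.inr h)))
    · exact Or.inr (Or.inr (Or.inr (Or.inl h)))

theorem symMove_swap {S : Finset Pt} {v w : Pt}
    (hc : v.1 ≠ v.2 ∧ w.1 ≠ w.2 ∧ v.1 ≠ w.1 ∧ v.2 ≠ w.2 ∧ v.1 ≠ w.2 ∧ v.2 ≠ w.1) :
    symMove S v.swap w.swap = symMove S v w := by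
  ext x
  rw [mem_symMove hc, mem_symMove (by simp only [Prod.fst_swap, Prod.snd_swap]; tauto)]
  simp only [Prod.fst_swap, Prod.snd_swap, Prod.swap_swap]
  tauto

/-- Each rectangle or its mirror image has all its squares in P, hence its corners as well. Position
in the plane thus tells which half of the current diagram a point belongs to, and P and -P^* are
never mixed. -/
theorem Transformation.isDescribedBy_of_area_le {Δ Δ' : Finset Pt} (T : Transformation Δ Δ')
    (hΔ : IsLatticePresentation Δ) {P : LatticePolytope} (hP : P.IsAssociated Δ Δ')
    (hd : P.DisjointFromMirror) (harea : T.area ≤ P.faceArea) : T.IsDescribedBy P := by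
  -- The invariant keeps the initial vertices in P and their mirror images in -P^*; carrying both
  -- clauses along replaces an appeal to the mirror symmetry of the carrier.
  let I : ℕ → LatticePolytope → Prop := fun j Q => Q.ver1 = P.ver1 ∧
    (∀ x ∈ Q.ver0, toPlane x ∈ P.carrier ∧ toPlane x.swap ∈ P.negMirror.carrier) ∧
    T.stage j = Q.ver0 ∪ mirrorSet Q.ver0
  have hver : ∀ {Q : LatticePolytope} {x : Pt}, x ∈ Q.ver0 ∨ x ∈ Q.ver1 →
      toPlane x ∈ Q.carrier := by
    intro Q x hx
    exact Or.inr ⟨x, by simpa using hx, rfl⟩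
  have hverm : ∀ {x : Pt}, x ∈ P.ver0 ∨ x ∈ P.ver1 → toPlane x.swap ∈ P.negMirror.carrier := by
    intro x hx
    refine hver ?_
    simpa [LatticePolytope.negMirror, mem_mirrorSet] using hx
  have key : ∀ (Q : LatticePolytope) (v w : Pt),
      (∀ x ∈ Q.ver0, toPlane x ∈ P.carrier ∧ toPlane x.swap ∈ P.negMirror.carrier) →
      v ∈ Q.ver0 ∪ mirrorSet Q.ver0 → w ∈ Q.ver0 ∪ mirrorSet Q.ver0 → v ≠ w →
      (v.1 ≠ v.2 ∧ w.1 ≠ w.2 ∧ v.1 ≠ w.1 ∧ v.2 ≠ w.2 ∧ v.1 ≠ w.2 ∧ v.2 ≠ w.1) →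
      (∀ p ∈ rectFaces v w, P.faceRot p ≠ 0) →
      ∃ Q' : LatticePolytope, Q'.ver1 = Q.ver1 ∧
        (∀ x ∈ Q'.ver0, toPlane x ∈ P.carrier ∧ toPlane x.swap ∈ P.negMirror.carrier) ∧
        symMove (Q.ver0 ∪ mirrorSet Q.ver0) v w = Q'.ver0 ∪ mirrorSet Q'.ver0 ∧
        Q.IsRectMove Q' v w := by
    intro Q v w hQ hv hw hvw hc hR
    have hcor : ∀ x : Pt, (x.1 = v.1 ∨ x.1 = w.1) → (x.2 = v.2 ∨ x.2 = w.2) →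
        toPlane x ∈ P.carrier ∧ toPlane x.swap ∈ P.negMirror.carrier := by
      intro x h1 h2
      refine ⟨LatticePolytope.rect_corner_mem_carrier hc.2.2.1 hc.2.2.2.1 hR h1 h2,
        LatticePolytope.rect_corner_mem_carrier (v := v.swap) (w := w.swap) hc.2.2.2.1 hc.2.2.1
          (fun p hp => ?_) h2 h1⟩
      rw [P.faceRot_negMirror]
      exact hR _ (rectFaces_swap.1 hp)
    have hmem : ∀ x, toPlane x ∈ P.carrier → x ∈ Q.ver0 ∪ mirrorSet Q.ver0 → x ∈ Q.ver0 := by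
      intro x hx hxm
      refine (Finset.mem_union.1 hxm).resolve_right fun h => hd.notMem hx ?_
      simpa using (hQ _ (mem_mirrorSet.1 h)).2
    have hv0 := hmem v (hcor v (Or.inl rfl) (Or.inl rfl)).1 hv
    have hw0 := hmem w (hcor w (Or.inr rfl) (Or.inr rfl)).1 hw
    refine ⟨Q.move hv0 hw0 hvw, rfl, ?_, ?_, hv0, hw0, hvw, rfl, rfl⟩
    · intro x hx
      rcases mem_rectMove.1 hx with hx | rfl | rfl
      · exact hQ x hx.1
      · exact hcor _ (Or.inr rfl) (Or.inl rfl)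
      · exact hcor _ (Or.inl rfl) (Or.inr rfl)
    · refine symMove_union_mirrorSet hc (fun h => ?_) fun h => ?_
      · exact hd.notMem (hQ _ h).1 (hQ _ hv0).2
      · exact hd.notMem (hQ _ h).1 (hQ _ hw0).2
  obtain ⟨Q, hQ0, hQI, hQR⟩ := exists_seq T.len I
    (fun j Q Q' => Q.IsRectMove Q' (T.v j) (T.w j) ∨
      Q.IsRectMove Q' (T.v j).swap (T.w j).swap) P
    ⟨rfl, fun x hx => ⟨hver (Or.inl hx), hverm (Or.inl hx)⟩, by
      rw [T.stage_zero, ← hP.union0]; rfl⟩ (by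
      rintro j hj Q ⟨hQ1, hQ2, hQ3⟩
      have hLP := T.isLatticePresentation_stage hΔ j hj.le
      have hc := hLP.coord_ne (T.v_mem j hj) (T.w_mem j hj) (T.ne j hj) (T.ne_swap j hj)
      have hv := T.v_mem j hj
      have hw := T.w_mem j hj
      have hv' := hLP.symm _ hv
      have hw' := hLP.symm _ hw
      rw [hQ3] at hv hw hv' hw'
      rcases T.rect_in_part hΔ hP hd harea hj with h | h
      · obtain ⟨Q', h1, h2, h3, h4⟩ := key Q _ _ hQ2 hv hw (T.ne j hj).symm hc h
        refine ⟨Q', ⟨h1.trans hQ1, h2, ?_⟩, Or.inl h4⟩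
        rw [T.stage_succ j hj, hQ3, h3]
      · obtain ⟨Q', h1, h2, h3, h4⟩ := key Q _ _ hQ2 hv' hw'
          (fun e => (T.ne j hj).symm (Prod.swap_injective e))
          (by simp only [Prod.fst_swap, Prod.snd_swap]; tauto) h
        refine ⟨Q', ⟨h1.trans hQ1, h2, ?_⟩, Or.inr h4⟩
        rw [T.stage_succ j hj, hQ3, ← h3, symMove_swap hc])
  refine ⟨Q, hQ0, ?_, hQR, fun j hj => (hQI j hj).2.2⟩
  obtain ⟨h1, h2, h3⟩ := hQI T.len le_rfl
  refine LatticePolytope.ext_ver ?_ h1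
  replace h3 := hP.union1.trans (T.stage_len.symm.trans h3)
  change (Q T.len).ver0 = P.ver1
  -- Both `(Q T.len).ver0` and `P.ver1` are the portion of Δ' that lies in P, hence they agree.
  have hm : ∀ x, toPlane x ∈ P.carrier → toPlane x ∉ P.negMirror.carrier := fun x h => hd.notMem h
  ext x
  constructor
  · intro hx
    have hx' : x ∈ P.ver1 ∪ P.negMirror.ver1 := h3 ▸ Finset.mem_union_left _ hx
    refine (Finset.mem_union.1 hx').resolve_right fun h => hm x (h2 x hx).1 (hver (Or.inr h))
  · intro hx
    have hx' : x ∈ (Q T.len).ver0 ∪ mirrorSet (Q T.len).ver0 := h3 ▸ Finset.mem_union_left _ hx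
    refine (Finset.mem_union.1 hx').resolve_right fun h => hm x (hver (Or.inr hx)) ?_
    simpa using (h2 _ (mem_mirrorSet.1 h)).2

theorem Transformation.exchanges_of_area_le {Δ Δ' : Finset Pt} (T : Transformation Δ Δ')
    (hΔ : IsLatticePresentation Δ) {P : LatticePolytope} (hP : P.IsAssociated Δ Δ')
    (hd : P.DisjointFromMirror) (harea : T.area ≤ P.faceArea) :
    T.ExchangesNestingCrossing := by
  intro j hj
  have hLP := T.isLatticePresentation_stage hΔ j hj.le
  have hc := hLP.coord_ne (T.v_mem j hj) (T.w_mem j hj) (T.ne j hj) (T.ne_swap j hj)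
  have hdiag : ∀ i : ℤ, ¬ ((min (T.v j).1 (T.w j).1 ≤ i ∧ i < max (T.v j).1 (T.w j).1) ∧
      (min (T.v j).2 (T.w j).2 ≤ i ∧ i < max (T.v j).2 (T.w j).2)) := by
    intro i hi
    have hm : ((i, i) : Pt) ∈ rectFaces (T.v j) (T.w j) := mem_rectFaces.2 hi
    have hF : P.faceRot (i, i) ≠ 0 := by
      simpa using T.rectFaces_subset hΔ hP hd harea hj hm
    exact hd.no_common_corner (p := (i, i)) (q := (i, i)) (x := (i, i)) hF hF (Or.inl rfl)
      (Or.inl rfl) (Or.inl rfl) (Or.inl rfl)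
  -- Two half-open intervals meet only if one of them contains the left end of the other, so these
  -- two instances make the horizontal and vertical ranges of the rectangle disjoint.
  have h1 := hdiag (min (T.v j).1 (T.w j).1)
  have h2 := hdiag (min (T.v j).2 (T.w j).2)
  generalize T.v j = v at *
  generalize T.w j = w at *
  obtain ⟨a, b⟩ := v
  obtain ⟨c, d⟩ := w
  simp only at hc h1 h2
  have key : ∀ a b c d : ℤ, a ≠ c → b ≠ d → a < b → a < d → c < b → c < d →
      (Nesting (a, b) (c, d) ∧ Crossing (c, b) (a, d)) ∨
        (Crossing (a, b) (c, d) ∧ Nesting (c, b) (a, d)) := by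
    intro a b c d h1 h2 h3 h4 h5 h6
    simp only [Nesting, Crossing]
    rcases lt_or_gt_of_ne h1 with h | h <;> rcases lt_or_gt_of_ne h2 with h' | h' <;>
      simp only [h, h', h3, h4, h5, h6, not_lt_of_gt, and_self, and_true, and_false,
        or_true, true_or]
  have hsep : (a < b ∧ a < d ∧ c < b ∧ c < d) ∨ (b < a ∧ d < a ∧ b < c ∧ d < c) := by
    clear hLP
    rcases lt_or_gt_of_ne hc.2.2.1 with h | h <;>
      rcases lt_or_gt_of_ne hc.2.2.2.1 with h' | h' <;>
      simp only [h.le, h'.le, min_eq_left, min_eq_right, max_eq_left, max_eq_right] at h1 h2 <;>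
      omega
  rcases hsep with ⟨h3, h4, h5, h6⟩ | ⟨h3, h4, h5, h6⟩
  · simp only [arc, min_eq_left h3.le, min_eq_left h4.le, min_eq_left h5.le, min_eq_left h6.le,
      max_eq_right h3.le, max_eq_right h4.le, max_eq_right h5.le, max_eq_right h6.le]
    exact key a b c d hc.2.2.1 hc.2.2.2.1 h3 h4 h5 h6
  · simp only [arc, min_eq_right h3.le, min_eq_right h4.le, min_eq_right h5.le,
      min_eq_right h6.le, max_eq_left h3.le, max_eq_left h4.le, max_eq_left h5.le,
      max_eq_left h6.le]
    exact (key b a d c hc.2.2.2.1 hc.2.2.1 h3 h5 h4 h6).imp (And.imp_right Or.symm)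
      (And.imp_right Or.symm)

/-! ### Transformations obtained from rectangle moves of a polytope -/

/-- A transformation preceded by one more step. -/
def Transformation.cons {Δ Δ' : Finset Pt} {v w : Pt} (hv : v ∈ Δ) (hw : w ∈ Δ) (h : w ≠ v)
    (h' : w ≠ v.swap) (T : Transformation (symMove Δ v w) Δ') : Transformation Δ Δ' where
  len := T.len + 1
  stage j := Nat.casesOn j Δ T.stage
  v j := Nat.casesOn j v T.v
  w j := Nat.casesOn j w T.w
  stage_zero := rfl
  stage_len := T.stage_len
  v_mem j hj := by
    cases j with
    | zero => exact hv
    | succ j => exact T.v_mem j (Nat.lt_of_succ_lt_succ hj)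
  w_mem j hj := by
    cases j with
    | zero => exact hw
    | succ j => exact T.w_mem j (Nat.lt_of_succ_lt_succ hj)
  ne j hj := by
    cases j with
    | zero => exact h
    | succ j => exact T.ne j (Nat.lt_of_succ_lt_succ hj)
  ne_swap j hj := by
    cases j with
    | zero => exact h'
    | succ j => exact T.ne_swap j (Nat.lt_of_succ_lt_succ hj)
  stage_succ j hj := by
    cases j with
    | zero => exact T.stage_zero
    | succ j => exact T.stage_succ j (Nat.lt_of_succ_lt_succ hj)

theorem Transformation.area_cons {Δ Δ' : Finset Pt} {v w : Pt} (hv : v ∈ Δ) (hw : w ∈ Δ)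
    (h : w ≠ v) (h' : w ≠ v.swap) (T : Transformation (symMove Δ v w) Δ') :
    (T.cons hv hw h h').area = |w.1 - v.1| * |w.2 - v.2| + T.area := by
  rw [Transformation.area, Transformation.area]
  exact (Finset.sum_range_succ' _ _).trans (add_comm _ _)

/-- Performing every move together with its mirror image costs the same area, as the area of a
transformation counts one rectangle of each pair. The hypothesis that no column index of S is a row
index makes the arcs involved distinct, and it persists because moves preserve the occupied lines.
-/
theorem RectChain.exists_transformation {S S' : Finset Pt} {n : ℤ} (h : RectChain S S' n)
    (hS : BiInj S) (hne : ∀ p ∈ S, ∀ q ∈ S, p.1 ≠ q.2) :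
    ∃ T : Transformation (S ∪ mirrorSet S) (S' ∪ mirrorSet S'), T.area = n := by
  induction h with
  | refl S =>
    exact ⟨⟨0, fun _ => S ∪ mirrorSet S, fun _ => 0, fun _ => 0, rfl, rfl, by simp, by simp,
      by simp, by simp, by simp⟩, by simp [Transformation.area]⟩
  | @step S S' n v w hv hw hvw _ ih =>
    have hL := sameLines_rectMove hv hw
    obtain ⟨T, hT⟩ := ih (hS.rectMove hv hw hvw) (by
      intro p hp q hq e
      obtain ⟨p', hp', e1⟩ := hL.symm.exists_fst hp
      obtain ⟨q', hq', e2⟩ := hL.symm.exists_snd hq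
      exact hne p' hp' q' hq' (by omega))
    have hsw : ∀ x ∈ S, x.swap ∉ S := fun x hx hx' => hne x.swap hx' x.swap hx' (by
      have := hne x hx x.swap hx'
      simp at this)
    have hc : v.1 ≠ v.2 ∧ w.1 ≠ w.2 ∧ v.1 ≠ w.1 ∧ v.2 ≠ w.2 ∧ v.1 ≠ w.2 ∧ v.2 ≠ w.1 :=
      ⟨hne v hv v hv, hne w hw w hw, hS.fst_ne hv hw hvw, hS.snd_ne hv hw hvw,
        hne v hv w hw, (hne w hw v hv).symm⟩
    obtain ⟨T, rfl⟩ : ∃ T : Transformation (symMove (S ∪ mirrorSet S) v w) (S' ∪ mirrorSet S'),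
        T.area = n := by
      rw [symMove_union_mirrorSet hc (hsw v hv) (hsw w hw)]
      exact ⟨T, hT⟩
    refine ⟨T.cons (Finset.mem_union_left _ hv) (Finset.mem_union_left _ hw) hvw.symm
      fun e => hsw v hv (e ▸ hw), ?_⟩
    exact T.area_cons _ _ _ _

theorem Transformation.HasMinimalArea.area_le {Δ Δ' : Finset Pt} {T : Transformation Δ Δ'}
    (hT : T.HasMinimalArea) (hΔ : IsLatticePresentation Δ) {P : LatticePolytope}
    (hP : P.IsAssociated Δ Δ') (h : RectChain P.ver0 P.ver1 P.faceArea) :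
    T.area ≤ P.faceArea := by
  obtain ⟨T', hT'⟩ := h.exists_transformation P.biInj_ver0 (by
    intro p hp q hq e
    have hq' : q.swap ∈ P.negMirror.ver0 := mem_mirrorSet.2 (by simpa using hq)
    have hpΔ : p ∈ Δ := hP.union0 ▸ Finset.mem_union_left _ hp
    have hqΔ : q.swap ∈ Δ := hP.union0 ▸ Finset.mem_union_right _ hq'
    have := hΔ.degree_le_one hpΔ hqΔ e
    exact Finset.disjoint_left.1 hP.disjoint0 hp (this ▸ hq'))
  obtain ⟨h0, h1, -, -⟩ := hP
  subst h0 h1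
  exact hT' ▸ hT T'

/-! ### Potentials of sets of unit steps -/

/-- `s` is a step of length one in one of the four axis directions. -/
def IsUnitStep (s : Pt × Pt) : Prop :=
  s.2 = (s.1.1 + 1, s.1.2) ∨ s.2 = (s.1.1 - 1, s.1.2) ∨ s.2 = (s.1.1, s.1.2 + 1) ∨
    s.2 = (s.1.1, s.1.2 - 1)

open Classical in
/-- The indicator function of a set of steps. -/
def ind (E : Set (Pt × Pt)) (s : Pt × Pt) : ℤ := if s ∈ E then 1 else 0

theorem ind_of_mem {E : Set (Pt × Pt)} {s : Pt × Pt} (h : s ∈ E) : ind E s = 1 := if_pos h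

theorem ind_of_notMem {E : Set (Pt × Pt)} {s : Pt × Pt} (h : s ∉ E) : ind E s = 0 := if_neg h

theorem ind_nonneg (E : Set (Pt × Pt)) (s : Pt × Pt) : 0 ≤ ind E s := by
  unfold ind
  split_ifs <;> norm_num

theorem mem_of_ind_pos {E : Set (Pt × Pt)} {s : Pt × Pt} (h : 0 < ind E s) : s ∈ E := by
  by_contra hs
  rw [ind_of_notMem hs] at h
  exact lt_irrefl _ h

/-- `F` is a function on the unit squares that vanishes far away and increases by one from the
right hand side to the left hand side of every step in `E`. -/
structure IsPotential (F : Pt → ℤ) (E : Set (Pt × Pt)) : Prop where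
  vert : ∀ i j, F (i - 1, j) - F (i, j) = ind E ((i, j), (i, j + 1)) - ind E ((i, j + 1), (i, j))
  horz : ∀ i j, F (i, j) - F (i, j - 1) = ind E ((i, j), (i + 1, j)) - ind E ((i + 1, j), (i, j))
  -- Nothing is demanded far to the left, where rays to the right may still cross the path;
  -- uniqueness is proved by moving leftwards along rows.
  zero : ∃ N : ℤ, ∀ p : Pt, (N ≤ p.1 ∨ p.2 < -N ∨ N ≤ p.2) → F p = 0

theorem row_induction {Q : ℤ → Prop} (N : ℤ) (h0 : ∀ i, N ≤ i → Q i)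
    (h : ∀ i, Q i → Q (i - 1)) (i : ℤ) : Q i := by
  rcases le_total N i with hi | hi
  · exact h0 i hi
  · induction i, hi using Int.leInductionDown with
    | base => exact h0 N le_rfl
    | pred k _ ih => exact h k ih

theorem IsPotential.eq_zero {F : Pt → ℤ} (h : IsPotential F ∅) (p : Pt) : F p = 0 := by
  obtain ⟨N, hN⟩ := h.zero
  refine row_induction (Q := fun i => F (i, p.2) = 0) N (fun i hi => hN _ (Or.inl hi))
    (fun i hi => ?_) p.1
  have := h.vert i p.2
  simp only [ind, Set.mem_empty_iff_false, if_false] at this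
  omega

/-- The mixed second difference of `F` at a lattice point. -/
def corner (F : Pt → ℤ) (x : Pt) : ℤ :=
  F (x.1, x.2) - F (x.1 - 1, x.2) - F (x.1, x.2 - 1) + F (x.1 - 1, x.2 - 1)

theorem corner_sum {ι : Type*} (s : Finset ι) (F : ι → Pt → ℤ) (x : Pt) :
    corner (fun p => ∑ i ∈ s, F i p) x = ∑ i ∈ s, corner (F i) x := by
  simp only [corner, Finset.sum_add_distrib, Finset.sum_sub_distrib]

theorem corner_add (F G : Pt → ℤ) (x : Pt) :
    corner (fun p => F p + G p) x = corner F x + corner G x := by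
  simp only [corner]
  ring

/-- The mixed difference is summed twice, first upwards and then to the right, starting where both
functions vanish. -/
theorem eq_of_corner_eq {F G : Pt → ℤ} {N : ℤ}
    (hF : ∀ p : Pt, (p.1 < -N ∨ p.2 < -N) → F p = 0)
    (hG : ∀ p : Pt, (p.1 < -N ∨ p.2 < -N) → G p = 0) (h : ∀ x, corner F x = corner G x) (p : Pt) :
    F p = G p := by
  have hd : ∀ i j : ℤ, F (i, j) - F (i - 1, j) = G (i, j) - G (i - 1, j) := by
    intro i j
    rcases lt_or_ge j (-N) with hj | hj
    · rw [hF _ (Or.inr hj), hF _ (Or.inr hj), hG _ (Or.inr hj), hG _ (Or.inr hj)]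
    · replace hj : -N - 1 ≤ j := by omega
      induction j, hj using Int.leInduction with
      | base =>
        have hj : -N - 1 < -N := by omega
        rw [hF _ (Or.inr hj), hF _ (Or.inr hj), hG _ (Or.inr hj), hG _ (Or.inr hj)]
      | succ j _ ih =>
        have := h (i, j + 1)
        simp only [corner, add_sub_cancel_right] at this
        omega
  obtain ⟨i, j⟩ := p
  rcases lt_or_ge i (-N) with hi | hi
  · rw [hF _ (Or.inl hi), hG _ (Or.inl hi)]
  · replace hi : -N - 1 ≤ i := by omega
    induction i, hi using Int.leInduction with
    | base =>
      have hi : -N - 1 < -N := by omega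
      rw [hF _ (Or.inl hi), hG _ (Or.inl hi)]
    | succ i _ ih =>
      have := hd (i + 1) j
      simp only [add_sub_cancel_right] at this
      omega

/-- The corner is computed here from the horizontal steps at `x` and in `corner_eq'` from the
vertical ones; equating the two gives the conservation law that as many steps enter `x` as leave it.
-/
theorem IsPotential.corner_eq {F : Pt → ℤ} {E : Set (Pt × Pt)} (h : IsPotential F E) (x : Pt) :
    corner F x = ind E (x, (x.1 + 1, x.2)) + ind E (x, (x.1 - 1, x.2)) -
      ind E ((x.1 + 1, x.2), x) - ind E ((x.1 - 1, x.2), x) := by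
  have h1 := h.horz x.1 x.2
  have h2 := h.horz (x.1 - 1) x.2
  rw [sub_add_cancel] at h2
  simp only [corner]
  linarith

theorem IsPotential.corner_eq' {F : Pt → ℤ} {E : Set (Pt × Pt)} (h : IsPotential F E) (x : Pt) :
    corner F x = ind E ((x.1, x.2 + 1), x) + ind E ((x.1, x.2 - 1), x) -
      ind E (x, (x.1, x.2 + 1)) - ind E (x, (x.1, x.2 - 1)) := by
  have h1 := h.vert x.1 x.2
  have h2 := h.vert x.1 (x.2 - 1)
  rw [sub_add_cancel] at h2
  simp only [corner]
  linarith

/-- A step of a set that has a potential is followed by a step of the set. -/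
theorem IsPotential.exists_next {F : Pt → ℤ} {E : Set (Pt × Pt)} (h : IsPotential F E)
    (hE : ∀ s ∈ E, IsUnitStep s) {a x : Pt} (ha : (a, x) ∈ E) : ∃ b, (x, b) ∈ E := by
  by_contra hcon
  push Not at hcon
  have h1 := h.corner_eq x
  have h2 := h.corner_eq' x
  rw [ind_of_notMem (hcon _), ind_of_notMem (hcon _)] at h1 h2
  have n1 := ind_nonneg E ((x.1 + 1, x.2), x)
  have n2 := ind_nonneg E ((x.1 - 1, x.2), x)
  have n3 := ind_nonneg E ((x.1, x.2 + 1), x)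
  have n4 := ind_nonneg E ((x.1, x.2 - 1), x)
  have ha1 := ind_of_mem ha
  obtain ⟨a1, a2⟩ := a
  obtain ⟨x1, x2⟩ := x
  rcases hE _ ha with e | e | e | e <;> simp only [Prod.mk.injEq] at e <;> obtain ⟨rfl, rfl⟩ := e <;>
    simp only [add_sub_cancel_right, sub_add_cancel] at * <;> omega

/-! ### Potentials of embedded closed paths -/

theorem rayCross_toPlane (e : Pt × Pt) (p : Pt) : rayCross e (toPlane p) =
    if p.1 < e.1.1 ∧ e.1.2 ≤ p.2 ∧ p.2 < e.2.2 then 1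
      else if p.1 < e.1.1 ∧ e.2.2 ≤ p.2 ∧ p.2 < e.1.2 then -1 else 0 := by
  rw [rayCross_eq_floor]
  simp [toPlane]

theorem rayCross_vert {s : Pt × Pt} (hs : IsUnitStep s) (i j : ℤ) :
    rayCross s (toPlane (i - 1, j)) - rayCross s (toPlane (i, j)) =
      (if s = ((i, j), (i, j + 1)) then 1 else 0) - if s = ((i, j + 1), (i, j)) then 1 else 0 := by
  obtain ⟨⟨a, b⟩, ⟨c, d⟩⟩ := s
  rcases hs with e | e | e | e <;> simp only [Prod.mk.injEq] at e <;> obtain ⟨rfl, rfl⟩ := e <;>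
    simp only [rayCross_toPlane, Prod.mk.injEq] <;> split_ifs <;> omega

/-- The last bracket is a function of the start of the step minus the same function of its end, so
it telescopes to zero along a closed path. -/
theorem rayCross_horz {s : Pt × Pt} (hs : IsUnitStep s) (i j : ℤ) :
    rayCross s (toPlane (i, j)) - rayCross s (toPlane (i, j - 1)) =
      ((if s = ((i, j), (i + 1, j)) then 1 else 0) - if s = ((i + 1, j), (i, j)) then 1 else 0) +
      ((if i < s.1.1 ∧ s.1.2 = j then 1 else 0) - if i < s.2.1 ∧ s.2.2 = j then 1 else 0) := by
  obtain ⟨⟨a, b⟩, ⟨c, d⟩⟩ := s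
  rcases hs with e | e | e | e <;> simp only [Prod.mk.injEq] at e <;> obtain ⟨rfl, rfl⟩ := e <;>
    simp only [rayCross_toPlane, Prod.mk.injEq] <;> split_ifs <;> omega

namespace LatticeCycle

variable (c : LatticeCycle)

/-- The rotation number around the points of the unit square with lower left corner `p`. -/
def faceRot (p : Pt) : ℤ := c.rot (toPlane p)

theorem rot_eq_faceRot (q : ℝ × ℝ) : c.rot q = c.faceRot (⌊q.1⌋, ⌊q.2⌋) := by
  simp only [faceRot, rot]
  refine Finset.sum_congr rfl fun i _ => ?_
  rw [rayCross_eq_floor, rayCross_toPlane]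

theorem sum_step_eq (s : Pt × Pt) :
    ∑ k ∈ Finset.range c.len, (if (c.pt k, c.pt (k + 1)) = s then 1 else 0) = ind c.steps s := by
  by_cases hs : s ∈ c.steps
  · rw [ind_of_mem hs]
    obtain ⟨k, hk, rfl⟩ := hs
    rw [Finset.sum_eq_single_of_mem k (Finset.mem_range.2 hk), if_pos rfl]
    intro l hl hlk
    exact if_neg fun e => hlk (c.inj (Finset.mem_range.1 hl) hk (congrArg Prod.fst e))
  · rw [ind_of_notMem hs]
    exact Finset.sum_eq_zero fun k hk => if_neg fun e => hs ⟨k, Finset.mem_range.1 hk, e.symm⟩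

variable {c}

theorem mem_steps {k : ℕ} (hk : k < c.len) : (c.pt k, c.pt (k + 1)) ∈ c.steps := ⟨k, hk, rfl⟩

theorem isPotential (h : ∀ s ∈ c.steps, IsUnitStep s) : IsPotential c.faceRot c.steps where
  vert i j := by
    rw [← c.sum_step_eq, ← c.sum_step_eq, ← Finset.sum_sub_distrib]
    simp only [faceRot, rot]
    rw [← Finset.sum_sub_distrib]
    exact Finset.sum_congr rfl fun k hk => rayCross_vert (h _ (mem_steps (Finset.mem_range.1 hk))) i j
  horz i j := by
    have htel : ∑ k ∈ Finset.range c.len,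
        ((if i < (c.pt k).1 ∧ (c.pt k).2 = j then 1 else 0) -
          if i < (c.pt (k + 1)).1 ∧ (c.pt (k + 1)).2 = j then 1 else 0 : ℤ) = 0 := by
      rw [Finset.sum_range_sub' (fun k => if i < (c.pt k).1 ∧ (c.pt k).2 = j then (1 : ℤ) else 0),
        c.closed, sub_self]
    rw [← c.sum_step_eq, ← c.sum_step_eq, ← Finset.sum_sub_distrib]
    simp only [faceRot, rot]
    rw [← Finset.sum_sub_distrib]
    have hsum := Finset.sum_congr rfl fun k (hk : k ∈ Finset.range c.len) =>
      rayCross_horz (h _ (mem_steps (Finset.mem_range.1 hk))) i j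
    rwa [Finset.sum_add_distrib, htel, add_zero] at hsum
  zero := by
    refine ⟨∑ k ∈ Finset.range (c.len + 1), (|(c.pt k).1| + |(c.pt k).2|), fun p hp => ?_⟩
    have hb : ∀ k ≤ c.len, |(c.pt k).1| + |(c.pt k).2| ≤
        ∑ k ∈ Finset.range (c.len + 1), (|(c.pt k).1| + |(c.pt k).2|) := fun k hk =>
      Finset.single_le_sum (f := fun k => |(c.pt k).1| + |(c.pt k).2|)
        (fun k _ => by positivity) (Finset.mem_range.2 (Nat.lt_succ_of_le hk))
    simp only [faceRot, rot]
    refine Finset.sum_eq_zero fun k hk => ?_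
    have hk := Finset.mem_range.1 hk
    have h1 := hb k hk.le
    have h2 := hb (k + 1) hk
    have e1 := abs_le.1 (le_refl |(c.pt k).1|)
    have e2 := abs_le.1 (le_refl |(c.pt k).2|)
    have e3 := abs_le.1 (le_refl |(c.pt (k + 1)).1|)
    have e4 := abs_le.1 (le_refl |(c.pt (k + 1)).2|)
    rw [rayCross_toPlane]
    dsimp only
    split_ifs <;> omega

theorem exists_next {a x : Pt} (h : (a, x) ∈ c.steps) : ∃ b, (x, b) ∈ c.steps := by
  obtain ⟨k, hk, e⟩ := h
  obtain ⟨rfl, rfl⟩ := Prod.mk.inj e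
  rcases Nat.lt_or_ge (k + 1) c.len with h | h
  · exact ⟨_, mem_steps h⟩
  · have : k + 1 = c.len := by omega
    rw [this, c.closed]
    exact ⟨_, mem_steps c.len_pos⟩

theorem exists_prev {x b : Pt} (h : (x, b) ∈ c.steps) : ∃ a, (a, x) ∈ c.steps := by
  obtain ⟨k, hk, e⟩ := h
  obtain ⟨rfl, rfl⟩ := Prod.mk.inj e
  cases k with
  | zero =>
    obtain ⟨l, hl⟩ := Nat.exists_eq_add_one_of_ne_zero c.len_pos.ne'
    refine ⟨c.pt l, l, by omega, ?_⟩
    rw [← c.closed, hl]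
  | succ k => exact ⟨_, mem_steps (by omega)⟩

theorem next_unique {x b b' : Pt} (h : (x, b) ∈ c.steps) (h' : (x, b') ∈ c.steps) : b = b' := by
  obtain ⟨k, hk, e⟩ := h
  obtain ⟨l, hl, e'⟩ := h'
  obtain ⟨rfl, rfl⟩ := Prod.mk.inj e
  obtain ⟨e1, rfl⟩ := Prod.mk.inj e'
  rw [c.inj hk hl e1]

theorem prev_unique {x a a' : Pt} (h : (a, x) ∈ c.steps) (h' : (a', x) ∈ c.steps) : a = a' := by
  obtain ⟨k, hk, e⟩ := h
  obtain ⟨l, hl, e'⟩ := h'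
  obtain ⟨rfl, rfl⟩ := Prod.mk.inj e
  obtain ⟨rfl, e1⟩ := Prod.mk.inj e'
  suffices k = l by rw [this]
  rcases Nat.lt_or_ge (k + 1) c.len with h1 | h1 <;> rcases Nat.lt_or_ge (l + 1) c.len with h2 | h2
  · exact Nat.succ_injective (c.inj h1 h2 e1)
  · rw [show l + 1 = c.len by omega, c.closed] at e1
    exact absurd (c.inj h1 c.len_pos e1) (Nat.succ_ne_zero k)
  · rw [show k + 1 = c.len by omega, c.closed] at e1
    exact absurd (c.inj c.len_pos h2 e1).symm (Nat.succ_ne_zero l)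
  · omega

/-- The unit square on the left hand side of a step. -/
def leftFace (s : Pt × Pt) : Pt :=
  if s.2.2 = s.1.2 + 1 then (s.1.1 - 1, s.1.2)
  else if s.2.2 = s.1.2 - 1 then s.2
  else if s.2.1 = s.1.1 + 1 then s.1
  else (s.2.1, s.2.2 - 1)

/-- An embedded path passes through `x` only once, so the squares around `x` on its left are not
separated from each other by any step. The hypothesis `hrev` excludes a U-turn. -/
theorem leftFace_eq (h : ∀ s ∈ c.steps, IsUnitStep s) (hrev : ∀ s ∈ c.steps, s.swap ∉ c.steps)
    {a x b : Pt} (ha : (a, x) ∈ c.steps) (hb : (x, b) ∈ c.steps) :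
    c.faceRot (leftFace (a, x)) = c.faceRot (leftFace (x, b)) := by
  have hin : ∀ y, (y, x) ∈ c.steps ↔ y = a :=
    fun y => ⟨fun hy => prev_unique hy ha, fun hy => hy ▸ ha⟩
  have hout : ∀ y, (x, y) ∈ c.steps ↔ y = b :=
    fun y => ⟨fun hy => next_unique hy hb, fun hy => hy ▸ hb⟩
  have hab : a ≠ b := fun e => hrev _ ha (e ▸ hb)
  have hP := isPotential h
  have h1 := hP.horz x.1 x.2
  have h2 := hP.horz (x.1 - 1) x.2
  have h3 := hP.vert x.1 x.2
  have h4 := hP.vert x.1 (x.2 - 1)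
  simp only [ind, sub_add_cancel, Prod.mk.eta, hin, hout] at h1 h2 h3 h4
  have ua := h _ ha
  have ub := h _ hb
  obtain ⟨a1, a2⟩ := a
  obtain ⟨b1, b2⟩ := b
  obtain ⟨x1, x2⟩ := x
  have n1 : ∀ t : ℤ, (t + 1 = t) = False := fun t => eq_false (by omega)
  have n2 : ∀ t : ℤ, (t - 1 = t) = False := fun t => eq_false (by omega)
  have n3 : ∀ t : ℤ, (t = t + 1) = False := fun t => eq_false (by omega)
  have n4 : ∀ t : ℤ, (t = t - 1) = False := fun t => eq_false (by omega)
  have n5 : ∀ t : ℤ, (t + 1 = t - 1) = False := fun t => eq_false (by omega)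
  have n6 : ∀ t : ℤ, (t - 1 = t + 1) = False := fun t => eq_false (by omega)
  have n7 : ∀ t : ℤ, (t = t + 1 + 1) = False := fun t => eq_false (by omega)
  have ua' : (a1 = x1 - 1 ∧ a2 = x2) ∨ (a1 = x1 + 1 ∧ a2 = x2) ∨ (a1 = x1 ∧ a2 = x2 - 1) ∨
      (a1 = x1 ∧ a2 = x2 + 1) := by
    simp only [IsUnitStep, Prod.mk.injEq] at ua
    omega
  simp only [IsUnitStep, Prod.mk.injEq] at ub
  clear hin hout ha hb h hP hrev ua
  rcases ua' with ⟨rfl, rfl⟩ | ⟨rfl, rfl⟩ | ⟨rfl, rfl⟩ | ⟨rfl, rfl⟩ <;>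
  rcases ub with ⟨rfl, rfl⟩ | ⟨rfl, rfl⟩ | ⟨rfl, rfl⟩ | ⟨rfl, rfl⟩ <;>
  first
  | exact absurd rfl hab
  | simp only [leftFace, Prod.mk.injEq, n1, n2, n3, n4, n5, n6, n7, add_sub_cancel_right,
      sub_add_cancel, and_false, false_and, and_self, if_true, if_false] at h1 h2 h3 h4 ⊢ <;>
    omega

end LatticeCycle

namespace LatticeCycle

variable {c : LatticeCycle}

/-- The rotation numbers of an embedded closed path are `0` and a fixed `ε ∈ {1, -1}`. -/
theorem exists_sign (h : ∀ s ∈ c.steps, IsUnitStep s) (hrev : ∀ s ∈ c.steps, s.swap ∉ c.steps) :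
    ∃ ε : ℤ, (ε = 1 ∨ ε = -1) ∧ ∀ p, c.faceRot p = 0 ∨ c.faceRot p = ε := by
  have hP := isPotential h
  obtain ⟨κ, hκ⟩ : ∃ κ, ∀ s ∈ c.steps, c.faceRot (leftFace s) = κ := by
    refine ⟨c.faceRot (leftFace (c.pt 0, c.pt 1)), ?_⟩
    rintro s ⟨k, hk, rfl⟩
    induction k with
    | zero => rfl
    | succ k ih =>
      rw [← ih (by omega)]
      exact (leftFace_eq h hrev (mem_steps (by omega)) (mem_steps hk)).symm
  -- All squares to the left of the path have the same value κ, so the squares to its right have the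
  -- value κ - 1, and elsewhere horizontally adjacent squares agree.
  have hv : ∀ i j, c.faceRot (i - 1, j) = c.faceRot (i, j) ∨
      ((c.faceRot (i - 1, j) = κ ∨ c.faceRot (i - 1, j) = κ - 1) ∧
        (c.faceRot (i, j) = κ ∨ c.faceRot (i, j) = κ - 1)) := by
    intro i j
    have hd := hP.vert i j
    by_cases hu : ((i, j), (i, j + 1)) ∈ c.steps
    · have h1 := hκ _ hu
      simp only [leftFace, if_true] at h1
      have hu2 : ((i, j + 1), (i, j)) ∉ c.steps := hrev _ hu
      rw [ind_of_mem hu, ind_of_notMem hu2] at hd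
      omega
    by_cases hu' : ((i, j + 1), (i, j)) ∈ c.steps
    · have h1 := hκ _ hu'
      rw [leftFace, if_neg (by simp only; omega), if_pos (by simp only; omega)] at h1
      rw [ind_of_mem hu', ind_of_notMem hu] at hd
      simp only at h1
      omega
    rw [ind_of_notMem hu, ind_of_notMem hu'] at hd
    exact Or.inl (by omega)
  obtain ⟨N, hN⟩ := hP.zero
  -- Along a row the value starts with 0 at the far right. If 0 is neither κ nor κ - 1, it can never
  -- change.
  by_cases h0 : κ = 0 ∨ κ = 1
  · have hval : ∀ p : Pt, c.faceRot p = κ ∨ c.faceRot p = κ - 1 := fun p =>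
      row_induction (Q := fun i => c.faceRot (i, p.2) = κ ∨ c.faceRot (i, p.2) = κ - 1) N
        (fun i hi => by rw [hN _ (Or.inl hi)]; omega)
        (fun i hi => by have := hv i p.2; omega) p.1
    rcases h0 with rfl | rfl
    · exact ⟨-1, Or.inr rfl, fun p => by have := hval p; omega⟩
    · exact ⟨1, Or.inl rfl, fun p => by have := hval p; omega⟩
  · exact ⟨1, Or.inl rfl, fun p => Or.inl
      (row_induction (Q := fun i => c.faceRot (i, p.2) = 0) N
        (fun i hi => hN _ (Or.inl hi)) (fun i hi => by have := hv i p.2; omega) p.1)⟩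

theorem center_notMem_trace (h : ∀ s ∈ c.steps, IsUnitStep s) (p : Pt) :
    ((p.1 : ℝ) + 1 / 2, (p.2 : ℝ) + 1 / 2) ∉ c.trace := by
  intro hq
  simp only [trace, Set.mem_iUnion] at hq
  obtain ⟨k, hk, a, b, -, -, hab, e⟩ := hq
  have nonint : ∀ m n : ℤ, (m : ℝ) + 1 / 2 ≠ n := by
    intro m n e
    have : (2 * m + 1 : ℤ) = 2 * n := by
      have : (2 * m + 1 : ℝ) = 2 * n := by linarith
      exact_mod_cast this
    omega
  have e1 := congrArg Prod.fst e
  have e2 := congrArg Prod.snd e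
  simp only [toPlane, Prod.fst_add, Prod.smul_fst, smul_eq_mul, Prod.snd_add, Prod.smul_snd]
    at e1 e2
  have hu := h _ (mem_steps (Finset.mem_range.1 hk))
  have hs : (c.pt (k + 1)).2 = (c.pt k).2 ∨ (c.pt (k + 1)).1 = (c.pt k).1 := by
    rcases hu with hu | hu | hu | hu <;> simp only at hu <;> rw [hu] <;> simp
  rcases hs with hs | hs
  · rw [hs, ← add_mul, hab, one_mul] at e2
    exact nonint _ _ e2.symm
  · rw [hs, ← add_mul, hab, one_mul] at e1
    exact nonint _ _ e1.symm

theorem rot_center (p : Pt) :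
    c.rot ((p.1 : ℝ) + 1 / 2, (p.2 : ℝ) + 1 / 2) = c.faceRot p := by
  have key : ∀ n : ℤ, ⌊(n : ℝ) + 1 / 2⌋ = n := fun n =>
    Int.floor_eq_iff.2 ⟨by linarith, by linarith⟩
  rw [rot_eq_faceRot, key, key]

theorem center_mem_inside (h : ∀ s ∈ c.steps, IsUnitStep s) {p : Pt} :
    ((p.1 : ℝ) + 1 / 2, (p.2 : ℝ) + 1 / 2) ∈ c.inside ↔ c.faceRot p ≠ 0 := by
  simp only [inside, Set.mem_ofPred_eq, rot_center, center_notMem_trace h, not_false_eq_true,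
    true_and]

end LatticeCycle

/-! ### Decomposition into embedded closed paths -/

theorem ind_diff {E C : Set (Pt × Pt)} (h : C ⊆ E) (s : Pt × Pt) :
    ind (E \ C) s = ind E s - ind C s := by
  by_cases h1 : s ∈ C
  · rw [ind_of_mem h1, ind_of_mem (h h1), ind_of_notMem (fun h2 : s ∈ E \ C => h2.2 h1), sub_self]
  · by_cases h2 : s ∈ E
    · rw [ind_of_notMem h1, ind_of_mem h2, ind_of_mem (show s ∈ E \ C from ⟨h2, h1⟩), sub_zero]
    · rw [ind_of_notMem h1, ind_of_notMem h2, ind_of_notMem (fun h3 : s ∈ E \ C => h2 h3.1), sub_zero]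

theorem IsPotential.sub {F G : Pt → ℤ} {E C : Set (Pt × Pt)} (hF : IsPotential F E)
    (hG : IsPotential G C) (h : C ⊆ E) : IsPotential (fun p => F p - G p) (E \ C) where
  vert i j := by
    rw [ind_diff h, ind_diff h]
    linarith [hF.vert i j, hG.vert i j]
  horz i j := by
    rw [ind_diff h, ind_diff h]
    linarith [hF.horz i j, hG.horz i j]
  zero := by
    obtain ⟨M, hM⟩ := hF.zero
    obtain ⟨N, hN⟩ := hG.zero
    refine ⟨max M N, fun p hp => ?_⟩
    rw [hM p (by omega), hN p (by omega), sub_zero]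

/-- Choose a successor for each end point of a step. On a finite set some point is periodic under
this choice, and its orbit over the minimal period has no repetition. -/
theorem IsPotential.exists_cycle {F : Pt → ℤ} {E : Set (Pt × Pt)} (h : IsPotential F E)
    (hE : ∀ s ∈ E, IsUnitStep s) (hfin : E.Finite) (hne : E.Nonempty) :
    ∃ c : LatticeCycle, c.steps ⊆ E := by
  let V : Set Pt := Prod.snd '' E
  have hVfin : Finite V := (hfin.image Prod.snd).to_subtype
  have hnext : ∀ x : V, ∃ y : V, ((x : Pt), (y : Pt)) ∈ E := by
    rintro ⟨x, ⟨a, x'⟩, ha, rfl⟩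
    obtain ⟨b, hb⟩ := h.exists_next hE ha
    exact ⟨⟨b, _, hb, rfl⟩, hb⟩
  choose f hf using hnext
  obtain ⟨s, hs⟩ := hne
  obtain ⟨m, n, hmn, e⟩ := Finite.exists_ne_map_eq_of_infinite
    fun n : ℕ => f^[n] (⟨s.2, s, hs, rfl⟩ : V)
  obtain ⟨y, hy⟩ : ∃ y : V, y ∈ Function.periodicPts f := by
    wlog hlt : m < n generalizing m n
    · exact this n m hmn.symm e.symm (lt_of_le_of_ne (not_lt.1 hlt) hmn.symm)
    refine ⟨f^[m] ⟨s.2, s, hs, rfl⟩, n - m, Nat.sub_pos_of_lt hlt, ?_⟩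
    rw [Function.IsPeriodicPt, Function.IsFixedPt, ← Function.iterate_add_apply,
      Nat.sub_add_cancel hlt.le]
    exact e.symm
  refine ⟨⟨Function.minimalPeriod f y, fun k => (f^[k] y : V),
    Function.minimalPeriod_pos_of_mem_periodicPts hy, ?_, ?_⟩, ?_⟩
  · simp only [Function.iterate_minimalPeriod, Function.iterate_zero, id]
  · intro k hk l hl e
    exact Function.iterate_injOn_Iio_minimalPeriod hk hl (Subtype.val_injective e)
  · rintro _ ⟨k, -, rfl⟩
    simp only [Function.iterate_succ_apply']
    exact hf _

/-- If all embedded closed paths have rotation numbers of the same sign, the potential has this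
sign. -/
theorem IsPotential.sign_of_cycles {ε : ℤ} {n : ℕ} : ∀ {F : Pt → ℤ} {E : Set (Pt × Pt)},
    E.ncard = n → IsPotential F E → (∀ s ∈ E, IsUnitStep s) → E.Finite →
    (∀ c : LatticeCycle, c.steps ⊆ E → ∀ p, 0 ≤ ε * c.faceRot p) → ∀ p, 0 ≤ ε * F p := by
  induction n using Nat.strong_induction_on with
  | _ n ih =>
    intro F E hn hF hE hfin hc p
    rcases E.eq_empty_or_nonempty with rfl | hne
    · rw [hF.eq_zero, mul_zero]
    -- The potential is that of the cycle plus that of the remaining, fewer steps, and both summands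
    -- have the required sign.
    obtain ⟨c, hcE⟩ := hF.exists_cycle hE hfin hne
    have hlt : (E \ c.steps).ncard < n := by
      rw [← hn]
      refine Set.ncard_lt_ncard (Set.ssubset_iff_of_subset Set.sdiff_subset |>.2 ?_) hfin
      exact ⟨_, hcE (LatticeCycle.mem_steps c.len_pos),
        fun h => h.2 (LatticeCycle.mem_steps c.len_pos)⟩
    have h1 := ih _ hlt rfl
      (hF.sub (LatticeCycle.isPotential fun s hs => hE s (hcE hs)) hcE)
      (fun s hs => hE s hs.1) (hfin.subset Set.sdiff_subset)
      (fun c' hc' => hc c' (hc'.trans Set.sdiff_subset)) p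
    have h2 := hc c hcE p
    linarith

namespace LatticePolytope

/-! ### The steps of the boundary of a lattice polytope -/

variable {P : LatticePolytope}

theorem isUnitStep_of_mem_steps {s : Pt × Pt} (hs : s ∈ P.steps) : IsUnitStep s := by
  obtain ⟨e, -, h⟩ := hs
  obtain ⟨⟨a, b⟩, ⟨c, d⟩⟩ := s
  simp only [IsUnitStepOf] at h
  simp only [IsUnitStep, Prod.mk.injEq]
  omega

theorem up_mem_steps {i j : ℤ} : ((i, j), (i, j + 1)) ∈ P.steps ↔
    ∃ s ∈ P.ver0, ∃ u ∈ P.ver1, s.1 = i ∧ u.1 = i ∧ u.2 ≤ j ∧ j < s.2 := by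
  constructor
  · rintro ⟨e, he, h⟩
    simp only [IsUnitStepOf] at h
    rcases Finset.mem_union.1 he with he | he
    · have := (mem_edgesX.1 he).2.1
      omega
    · obtain ⟨⟨h1, h2⟩, h3, -⟩ := mem_edgesY.1 he
      exact ⟨e.2, h2, e.1, h1, by omega, by omega, by omega, by omega⟩
  · rintro ⟨s, hs, u, hu, h1, h2, h3, h4⟩
    refine ⟨(u, s), Finset.mem_union_right _ (mem_edgesY.2 ⟨⟨hu, hs⟩, ?_, ?_⟩), ?_⟩
    · simp only
      omega
    · rintro (rfl : u = s)
      omega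
    · refine Or.inr ⟨?_, ?_, ?_, Or.inl ⟨?_, ?_, ?_⟩⟩ <;> dsimp only <;> omega

theorem down_mem_steps {i j : ℤ} : ((i, j + 1), (i, j)) ∈ P.steps ↔
    ∃ s ∈ P.ver0, ∃ u ∈ P.ver1, s.1 = i ∧ u.1 = i ∧ s.2 ≤ j ∧ j < u.2 := by
  constructor
  · rintro ⟨e, he, h⟩
    simp only [IsUnitStepOf] at h
    rcases Finset.mem_union.1 he with he | he
    · have := (mem_edgesX.1 he).2.1
      omega
    · obtain ⟨⟨h1, h2⟩, h3, -⟩ := mem_edgesY.1 he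
      exact ⟨e.2, h2, e.1, h1, by omega, by omega, by omega, by omega⟩
  · rintro ⟨s, hs, u, hu, h1, h2, h3, h4⟩
    refine ⟨(u, s), Finset.mem_union_right _ (mem_edgesY.2 ⟨⟨hu, hs⟩, ?_, ?_⟩), ?_⟩
    · simp only
      omega
    · rintro (rfl : u = s)
      omega
    · refine Or.inr ⟨?_, ?_, ?_, Or.inr ⟨?_, ?_, ?_⟩⟩ <;> dsimp only <;> omega

theorem right_mem_steps {i j : ℤ} : ((i, j), (i + 1, j)) ∈ P.steps ↔
    ∃ s ∈ P.ver0, ∃ u ∈ P.ver1, s.2 = j ∧ u.2 = j ∧ s.1 ≤ i ∧ i < u.1 := by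
  constructor
  · rintro ⟨e, he, h⟩
    simp only [IsUnitStepOf] at h
    rcases Finset.mem_union.1 he with he | he
    · obtain ⟨⟨h1, h2⟩, h3, -⟩ := mem_edgesX.1 he
      exact ⟨e.1, h1, e.2, h2, by omega, by omega, by omega, by omega⟩
    · have := (mem_edgesY.1 he).2.1
      omega
  · rintro ⟨s, hs, u, hu, h1, h2, h3, h4⟩
    refine ⟨(s, u), Finset.mem_union_left _ (mem_edgesX.2 ⟨⟨hs, hu⟩, ?_, ?_⟩), ?_⟩
    · simp only
      omega
    · rintro (rfl : s = u)
      omega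
    · refine Or.inl ⟨?_, ?_, ?_, Or.inl ⟨?_, ?_, ?_⟩⟩ <;> dsimp only <;> omega

theorem left_mem_steps {i j : ℤ} : ((i + 1, j), (i, j)) ∈ P.steps ↔
    ∃ s ∈ P.ver0, ∃ u ∈ P.ver1, s.2 = j ∧ u.2 = j ∧ u.1 ≤ i ∧ i < s.1 := by
  constructor
  · rintro ⟨e, he, h⟩
    simp only [IsUnitStepOf] at h
    rcases Finset.mem_union.1 he with he | he
    · obtain ⟨⟨h1, h2⟩, h3, -⟩ := mem_edgesX.1 he
      exact ⟨e.1, h1, e.2, h2, by omega, by omega, by omega, by omega⟩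
    · have := (mem_edgesY.1 he).2.1
      omega
  · rintro ⟨s, hs, u, hu, h1, h2, h3, h4⟩
    refine ⟨(s, u), Finset.mem_union_left _ (mem_edgesX.2 ⟨⟨hs, hu⟩, ?_, ?_⟩), ?_⟩
    · simp only
      omega
    · rintro (rfl : s = u)
      omega
    · refine Or.inl ⟨?_, ?_, ?_, Or.inr ⟨?_, ?_, ?_⟩⟩ <;> dsimp only <;> omega

theorem eq_of_fst_eq {s s' u u' : Pt} (hs : s ∈ P.ver0) (hs' : s' ∈ P.ver0) (hu : u ∈ P.ver1)
    (hu' : u' ∈ P.ver1) (h : s.1 = s'.1) (h' : u.1 = u'.1) : s = s' ∧ u = u' :=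
  ⟨(P.biInj_ver0 s hs s' hs').1 h, (P.biInj_ver1 u hu u' hu').1 h'⟩

theorem eq_of_snd_eq {s s' u u' : Pt} (hs : s ∈ P.ver0) (hs' : s' ∈ P.ver0) (hu : u ∈ P.ver1)
    (hu' : u' ∈ P.ver1) (h : s.2 = s'.2) (h' : u.2 = u'.2) : s = s' ∧ u = u' :=
  ⟨(P.biInj_ver0 s hs s' hs').2 h, (P.biInj_ver1 u hu u' hu').2 h'⟩

theorem not_up_and_down {i j : ℤ} (h : ((i, j), (i, j + 1)) ∈ P.steps) :
    ((i, j + 1), (i, j)) ∉ P.steps := by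
  rw [up_mem_steps] at h
  rw [down_mem_steps]
  rintro ⟨s', hs', u', hu', h1', h2', h3', h4'⟩
  obtain ⟨s, hs, u, hu, h1, h2, h3, h4⟩ := h
  obtain ⟨rfl, rfl⟩ := eq_of_fst_eq hs hs' hu hu' (by omega) (by omega)
  omega

theorem not_right_and_left {i j : ℤ} (h : ((i, j), (i + 1, j)) ∈ P.steps) :
    ((i + 1, j), (i, j)) ∉ P.steps := by
  rw [right_mem_steps] at h
  rw [left_mem_steps]
  rintro ⟨s', hs', u', hu', h1', h2', h3', h4'⟩
  obtain ⟨s, hs, u, hu, h1, h2, h3, h4⟩ := h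
  obtain ⟨rfl, rfl⟩ := eq_of_snd_eq hs hs' hu hu' (by omega) (by omega)
  omega

theorem swap_notMem_steps {s : Pt × Pt} (hs : s ∈ P.steps) : s.swap ∉ P.steps := by
  intro hs'
  have hu := isUnitStep_of_mem_steps hs
  obtain ⟨⟨a, b⟩, ⟨c, d⟩⟩ := s
  simp only [IsUnitStep, Prod.mk.injEq] at hu
  simp only [Prod.swap_prod_mk] at hs'
  rcases hu with ⟨rfl, rfl⟩ | ⟨h, rfl⟩ | ⟨rfl, rfl⟩ | ⟨rfl, h⟩
  · exact not_right_and_left hs hs'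
  · obtain rfl : a = c + 1 := by omega
    exact not_right_and_left hs' hs
  · exact not_up_and_down hs hs'
  · obtain rfl : b = d + 1 := by omega
    exact not_up_and_down hs' hs

theorem sum_column {S : Finset Pt} (hS : BiInj S) {x : Pt} (hx : x ∈ S) (j : ℤ) :
    (∑ y ∈ S, if y.1 = x.1 ∧ y.2 ≤ j then 1 else 0 : ℤ) = if x.2 ≤ j then 1 else 0 := by
  rw [Finset.sum_eq_single_of_mem x hx]
  · simp
  · exact fun y hy hyx => if_neg fun h => hyx ((hS y hy x hx).1 h.1)

theorem sum_row {S : Finset Pt} (hS : BiInj S) {x : Pt} (hx : x ∈ S) (i : ℤ) :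
    (∑ y ∈ S, if y.2 = x.2 ∧ y.1 ≤ i then 1 else 0 : ℤ) = if x.1 ≤ i then 1 else 0 := by
  rw [Finset.sum_eq_single_of_mem x hx]
  · simp
  · exact fun y hy hyx => if_neg fun h => hyx ((hS y hy x hx).2 h.1)

theorem cnt_sub_left (S : Finset Pt) (i j : ℤ) : cnt S (i, j) - cnt S (i - 1, j) =
    ∑ y ∈ S, if y.1 = i ∧ y.2 ≤ j then 1 else 0 := by
  rw [cnt, cnt, ← Finset.sum_sub_distrib]
  refine Finset.sum_congr rfl fun y _ => ?_
  simp only [quad]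
  split_ifs <;> omega

theorem cnt_sub_below (S : Finset Pt) (i j : ℤ) : cnt S (i, j) - cnt S (i, j - 1) =
    ∑ y ∈ S, if y.2 = j ∧ y.1 ≤ i then 1 else 0 := by
  rw [cnt, cnt, ← Finset.sum_sub_distrib]
  refine Finset.sum_congr rfl fun y _ => ?_
  simp only [quad]
  split_ifs <;> omega

-- Every occupied line contains exactly one initial and one terminal vertex, so the steps on it are
-- those between these two points, all in one direction. The jump of each `cnt` across the line only
-- records whether its vertex has been passed.
variable (P) in
theorem isPotential : IsPotential P.faceRot P.steps where
  vert i j := by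
    have h0 := cnt_sub_left P.ver0 i j
    have h1 := cnt_sub_left P.ver1 i j
    by_cases hex : ∃ s ∈ P.ver0, s.1 = i
    · obtain ⟨s, hs, rfl⟩ := hex
      obtain ⟨u, hu, hus⟩ := P.sameLines.exists_fst hs
      rw [sum_column P.biInj_ver0 hs] at h0
      rw [← hus, sum_column P.biInj_ver1 hu, hus] at h1
      have e1 : ((s.1, j), (s.1, j + 1)) ∈ P.steps ↔ u.2 ≤ j ∧ j < s.2 := by
        rw [up_mem_steps]
        constructor
        · rintro ⟨s', hs', u', hu', h1', h2', h3⟩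
          obtain ⟨rfl, rfl⟩ := eq_of_fst_eq hs hs' hu hu' h1'.symm (hus.trans h2'.symm)
          exact h3
        · exact fun h => ⟨s, hs, u, hu, rfl, hus, h⟩
      have e2 : ((s.1, j + 1), (s.1, j)) ∈ P.steps ↔ s.2 ≤ j ∧ j < u.2 := by
        rw [down_mem_steps]
        constructor
        · rintro ⟨s', hs', u', hu', h1', h2', h3⟩
          obtain ⟨rfl, rfl⟩ := eq_of_fst_eq hs hs' hu hu' h1'.symm (hus.trans h2'.symm)
          exact h3
        · exact fun h => ⟨s, hs, u, hu, rfl, hus, h⟩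
      simp only [ind, e1, e2, faceRot]
      split_ifs at h0 h1 ⊢ <;> omega
    · push Not at hex
      rw [Finset.sum_eq_zero fun y hy => if_neg fun h => hex y hy h.1] at h0
      rw [Finset.sum_eq_zero fun y hy => if_neg fun h => by
        obtain ⟨s, hs, e⟩ := P.sameLines.symm.exists_fst hy
        exact hex s hs (e.trans h.1)] at h1
      rw [ind_of_notMem, ind_of_notMem, faceRot, faceRot]
      · omega
      · rw [down_mem_steps]
        rintro ⟨s, hs, -, -, h, -⟩
        exact hex s hs h
      · rw [up_mem_steps]
        rintro ⟨s, hs, -, -, h, -⟩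
        exact hex s hs h
  horz i j := by
    have h0 := cnt_sub_below P.ver0 i j
    have h1 := cnt_sub_below P.ver1 i j
    by_cases hex : ∃ s ∈ P.ver0, s.2 = j
    · obtain ⟨s, hs, rfl⟩ := hex
      obtain ⟨u, hu, hus⟩ := P.sameLines.exists_snd hs
      rw [sum_row P.biInj_ver0 hs] at h0
      rw [← hus, sum_row P.biInj_ver1 hu, hus] at h1
      have e1 : ((i, s.2), (i + 1, s.2)) ∈ P.steps ↔ s.1 ≤ i ∧ i < u.1 := by
        rw [right_mem_steps]
        constructor
        · rintro ⟨s', hs', u', hu', h1', h2', h3⟩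
          obtain ⟨rfl, rfl⟩ := eq_of_snd_eq hs hs' hu hu' h1'.symm (hus.trans h2'.symm)
          exact h3
        · exact fun h => ⟨s, hs, u, hu, rfl, hus, h⟩
      have e2 : ((i + 1, s.2), (i, s.2)) ∈ P.steps ↔ u.1 ≤ i ∧ i < s.1 := by
        rw [left_mem_steps]
        constructor
        · rintro ⟨s', hs', u', hu', h1', h2', h3⟩
          obtain ⟨rfl, rfl⟩ := eq_of_snd_eq hs hs' hu hu' h1'.symm (hus.trans h2'.symm)
          exact h3
        · exact fun h => ⟨s, hs, u, hu, rfl, hus, h⟩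
      simp only [ind, e1, e2, faceRot]
      split_ifs at h0 h1 ⊢ <;> omega
    · push Not at hex
      rw [Finset.sum_eq_zero fun y hy => if_neg fun h => hex y hy h.1] at h0
      rw [Finset.sum_eq_zero fun y hy => if_neg fun h => by
        obtain ⟨s, hs, e⟩ := P.sameLines.symm.exists_snd hy
        exact hex s hs (e.trans h.1)] at h1
      rw [ind_of_notMem, ind_of_notMem, faceRot, faceRot]
      · omega
      · rw [left_mem_steps]
        rintro ⟨s, hs, -, -, h, -⟩
        exact hex s hs h
      · rw [right_mem_steps]
        rintro ⟨s, hs, -, -, h, -⟩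
        exact hex s hs h
  zero := by
    obtain ⟨N, hN⟩ := P.exists_box
    exact ⟨N, fun p hp => hN p (by tauto)⟩

variable (P) in
theorem finite_steps : P.steps.Finite := by
  have : P.steps = ⋃ e ∈ P.edges, {s | IsUnitStepOf e s} := by
    ext s
    simp [steps]
  rw [this]
  refine Set.Finite.biUnion P.edges.finite_toSet fun e _ => ?_
  let B : Finset Pt := Finset.Icc (min e.1.1 e.2.1) (max e.1.1 e.2.1) ×ˢ
    Finset.Icc (min e.1.2 e.2.2) (max e.1.2 e.2.2)
  refine (B ×ˢ B).finite_toSet.subset fun s hs => ?_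
  simp only [Set.mem_ofPred_eq, IsUnitStepOf] at hs
  simp only [B, Finset.coe_product, Set.mem_prod, Finset.coe_Icc, Set.mem_Icc]
  omega

/-- Under condition (1) the initial vertices are transformed into the terminal vertices by
rectangle moves of total area `Area|P|`. -/
theorem Condition1.rectChain (h : P.Condition1) : RectChain P.ver0 P.ver1 P.faceArea := by
  obtain ⟨ε, hε, h⟩ := h
  have hunit : ∀ c : LatticeCycle, c.InBoundary P → ∀ s ∈ c.steps, IsUnitStep s :=
    fun c hc s hs => isUnitStep_of_mem_steps (hc hs)
  have hsign : ∀ p, 0 ≤ ε * P.faceRot p := by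
    refine P.isPotential.sign_of_cycles rfl (fun s hs => isUnitStep_of_mem_steps hs)
      P.finite_steps fun c hc p => ?_
    by_cases h0 : c.faceRot p = 0
    · rw [h0, mul_zero]
    · have := h c hc _ ((LatticeCycle.center_mem_inside (hunit c hc)).2 h0)
      rw [LatticeCycle.rot_center] at this
      rw [this]
      exact mul_self_nonneg ε
  refine rectChain_of_sign P.faces P.biInj_ver0 P.biInj_ver1 P.sameLines ?_
    fun p hp => not_not.1 (mt mem_faces.2 hp)
  rcases hε with rfl | rfl
  · exact Or.inl fun p => by simpa [faceRot] using hsign p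
  · exact Or.inr fun p => by simpa [faceRot] using hsign p

end LatticePolytope

/-! ### Moving along one polygon -/

/-- The mixed second difference undoes the double summation in `cnt`; a set of points is thus
recovered from its counting function. -/
theorem corner_cnt (S : Finset Pt) (x : Pt) : corner (cnt S) x = if x ∈ S then 1 else 0 := by
  have h : ∀ y, corner (quad y) x = if x = y then 1 else 0 := by
    intro y
    simp only [corner, quad, Prod.ext_iff]
    split_ifs <;> omega
  have : cnt S = fun p => ∑ y ∈ S, quad y p := rfl
  rw [this, corner_sum, Finset.sum_congr rfl fun y _ => h y, Finset.sum_ite_eq]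

theorem cnt_eq_zero {S : Finset Pt} {N : ℤ} (h : ∀ x ∈ S, -N ≤ x.1 ∧ -N ≤ x.2) {p : Pt}
    (hp : p.1 < -N ∨ p.2 < -N) : cnt S p = 0 := by
  refine Finset.sum_eq_zero fun x hx => ?_
  have := h x hx
  rw [quad, if_neg]
  omega

theorem biInj_of_card {S T : Finset Pt} (hS : BiInj S)
    (h1 : ∀ i, (S.filter fun x => x.1 = i).card = (T.filter fun x => x.1 = i).card)
    (h2 : ∀ j, (S.filter fun x => x.2 = j).card = (T.filter fun x => x.2 = j).card) :
    BiInj T ∧ SameLines S T := by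
  constructor
  · intro p hp q hq
    constructor
    · intro e
      have hc : (T.filter fun x => x.1 = p.1).card ≤ 1 := by
        rw [← h1, Finset.card_le_one]
        intro a ha b hb
        rw [Finset.mem_filter] at ha hb
        exact (hS a ha.1 b hb.1).1 (ha.2.trans hb.2.symm)
      exact Finset.card_le_one.1 hc p (by simp [hp]) q (by simp [hq, e])
    · intro e
      have hc : (T.filter fun x => x.2 = p.2).card ≤ 1 := by
        rw [← h2, Finset.card_le_one]
        intro a ha b hb
        rw [Finset.mem_filter] at ha hb
        exact (hS a ha.1 b hb.1).2 (ha.2.trans hb.2.symm)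
      exact Finset.card_le_one.1 hc p (by simp [hp]) q (by simp [hq, e])
  · have aux : ∀ {U V : Finset Pt} (f : Pt → ℤ),
        (∀ i, (U.filter fun x => f x = i).card = (V.filter fun x => f x = i).card) →
        ∀ p ∈ U, ∃ q ∈ V, f q = f p := by
      intro U V f h p hp
      have : 0 < (V.filter fun x => f x = f p).card := by
        rw [← h]
        exact Finset.card_pos.2 ⟨p, by simp [hp]⟩
      obtain ⟨q, hq⟩ := Finset.card_pos.1 this
      exact ⟨q, (Finset.mem_filter.1 hq).1, (Finset.mem_filter.1 hq).2⟩
    exact SameLines.of_exists (aux _ h1) (aux _ fun i => (h1 i).symm) (aux _ h2)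
      (aux _ fun i => (h2 i).symm)

/-- A function of constant sign on the unit squares, whose positive corners are in `S`, describes
a sequence of rectangle moves of `S`. -/
theorem exists_rectChain_of_corner {f : Pt → ℤ} {N : ℤ} (K : Finset Pt)
    (hN : ∀ p : Pt, (p.1 < -N ∨ N ≤ p.1 ∨ p.2 < -N ∨ N ≤ p.2) → f p = 0)
    (hK : ∀ p, p ∉ K → f p = 0) (hsign : (∀ p, 0 ≤ f p) ∨ ∀ p, f p ≤ 0)
    (hcor : ∀ x, |corner f x| ≤ 1) {S : Finset Pt} (hS : BiInj S)
    (hA : ∀ x, 0 < corner f x → x ∈ S) :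
    ∃ T, BiInj T ∧ RectChain S T (∑ p ∈ K, |f p|) ∧
      ∀ x, (if x ∈ T then 1 else 0 : ℤ) = (if x ∈ S then 1 else 0) - corner f x := by
  -- If a negative corner `x` belonged to S, it would be the only point of S in its column, so this
  -- column would contain no positive corner. The jump of `f` across the column would be decreasing
  -- in height, yet it vanishes at both ends and so everywhere, and `x` would be no corner.
  have hB : ∀ x, corner f x < 0 → x ∉ S := by
    intro x hx hxS
    have hanti : Antitone fun y => f (x.1, y) - f (x.1 - 1, y) := by
      refine antitone_int_of_succ_le fun y => ?_
      by_contra hcon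
      have hpos : 0 < corner f (x.1, y + 1) := by
        simp only [corner, add_sub_cancel_right]
        omega
      have := (hS x hxS _ (hA _ hpos)).1 rfl
      rw [← this] at hpos
      omega
    have h1 := hanti (show x.2 ≤ max N x.2 by omega)
    have h2 := hanti (show min (-N - 1) (x.2 - 1) ≤ x.2 - 1 by omega)
    simp only at h1 h2
    rw [hN (x.1, max N x.2) (by simp only; omega), hN (x.1 - 1, max N x.2) (by simp only; omega)]
      at h1
    rw [hN (x.1, min (-N - 1) (x.2 - 1)) (by simp only; omega),
      hN (x.1 - 1, min (-N - 1) (x.2 - 1)) (by simp only; omega)] at h2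
    simp only [corner] at hx
    omega
  set B : Finset Pt := (Finset.Icc (-N) N ×ˢ Finset.Icc (-N) N).filter fun x => corner f x < 0
  have hBmem : ∀ x, x ∈ B ↔ corner f x < 0 := by
    intro x
    simp only [B, Finset.mem_filter, Finset.mem_product, Finset.mem_Icc, and_iff_right_iff_imp]
    intro hx
    by_contra hcon
    rw [corner, hN _ (by simp only; omega), hN _ (by simp only; omega), hN _ (by simp only; omega),
      hN _ (by simp only; omega)] at hx
    simp at hx
  -- The new set loses the positive corners of `f` and gains the negative ones.
  set T : Finset Pt := S.filter (fun x => corner f x ≤ 0) ∪ B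
  have hT : ∀ x, (if x ∈ T then 1 else 0 : ℤ) = (if x ∈ S then 1 else 0) - corner f x := by
    intro x
    have h1 := abs_le.1 (hcor x)
    have h2 := hA x
    have h3 := hB x
    have hTm : x ∈ T ↔ (x ∈ S ∧ corner f x ≤ 0) ∨ corner f x < 0 := by
      simp only [T, Finset.mem_union, Finset.mem_filter, hBmem]
    simp only [hTm]
    by_cases hx : x ∈ S
    · have : ¬ corner f x < 0 := fun h => h3 h hx
      simp only [hx, true_and, if_true]
      split_ifs <;> omega
    · have : ¬ 0 < corner f x := fun h => hx (h2 h)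
      simp only [hx, false_and, false_or, if_false]
      split_ifs <;> omega
  obtain ⟨M, hM⟩ : ∃ M, ∀ x ∈ S ∪ T, |x.1| + |x.2| ≤ M :=
    ⟨∑ x ∈ S ∪ T, (|x.1| + |x.2|), fun x hx =>
      Finset.single_le_sum (f := fun x : Pt => |x.1| + |x.2|) (fun x _ => by positivity) hx⟩
  have hb : ∀ x ∈ S ∪ T, -M ≤ x.1 ∧ x.1 ≤ M ∧ -M ≤ x.2 ∧ x.2 ≤ M := by
    intro x hx
    have := hM x hx
    have e1 := abs_le.1 (le_refl |x.1|)
    have e2 := abs_le.1 (le_refl |x.2|)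
    omega
  have hcnt : ∀ p, cnt S p - cnt T p = f p := by
    refine eq_of_corner_eq (F := fun p => cnt S p - cnt T p) (N := max M N) (fun p hp => ?_)
      (fun p hp => hN p (by omega)) fun x => ?_
    · have h0 : ∀ U ⊆ S ∪ T, cnt U p = 0 := fun U hU =>
        cnt_eq_zero (N := max M N) (fun x hx => by have := hb x (hU hx); omega) hp
      simp only [h0 S Finset.subset_union_left, h0 T Finset.subset_union_right, sub_self]
    · have h1 := corner_cnt S x
      have h2 := corner_cnt T x
      have h3 := hT x
      simp only [corner] at h1 h2 h3 ⊢
      omega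
  -- The number of points on a line is a difference of values of `cnt` at a far end of that line.
  -- There `f` vanishes, so S and T have equally many points on every line.
  have hrow : ∀ U ⊆ S ∪ T, ∀ j, ((U.filter fun x => x.2 = j).card : ℤ) =
      cnt U (max M N, j) - cnt U (max M N, j - 1) := by
    intro U hU j
    rw [LatticePolytope.cnt_sub_below, Finset.card_filter]
    push_cast
    refine Finset.sum_congr rfl fun x hx => ?_
    have := hb x (hU hx)
    split_ifs <;> omega
  have hcol : ∀ U ⊆ S ∪ T, ∀ i, ((U.filter fun x => x.1 = i).card : ℤ) =
      cnt U (i, max M N) - cnt U (i - 1, max M N) := by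
    intro U hU i
    rw [LatticePolytope.cnt_sub_left, Finset.card_filter]
    push_cast
    refine Finset.sum_congr rfl fun x hx => ?_
    have := hb x (hU hx)
    split_ifs <;> omega
  obtain ⟨hTB, hST⟩ : BiInj T ∧ SameLines S T := by
    refine biInj_of_card hS (fun i => ?_) fun j => ?_
    · have h1 := hcol S Finset.subset_union_left i
      have h2 := hcol T Finset.subset_union_right i
      have h3 := hcnt (i, max M N)
      have h4 := hcnt (i - 1, max M N)
      rw [hN _ (by simp only; omega)] at h3 h4
      omega
    · have h1 := hrow S Finset.subset_union_left j
      have h2 := hrow T Finset.subset_union_right j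
      have h3 := hcnt (max M N, j)
      have h4 := hcnt (max M N, j - 1)
      rw [hN _ (by simp only; omega)] at h3 h4
      omega
  refine ⟨T, hTB, ?_, hT⟩
  have := rectChain_of_sign K hS hTB hST (by simpa only [hcnt] using hsign)
    (by simpa only [hcnt] using hK)
  simpa only [hcnt] using this

/-! ### Corners of embedded closed paths -/

namespace LatticeCycle

variable {c : LatticeCycle}

theorem ind_next_add_le {x b b' : Pt} (h : b ≠ b') :
    ind c.steps (x, b) + ind c.steps (x, b') ≤ 1 := by
  unfold ind
  split_ifs with h1 h2
  · exact absurd (next_unique h1 h2) h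
  all_goals norm_num

theorem ind_prev_add_le {x a a' : Pt} (h : a ≠ a') :
    ind c.steps (a, x) + ind c.steps (a', x) ≤ 1 := by
  unfold ind
  split_ifs with h1 h2
  · exact absurd (prev_unique h1 h2) h
  all_goals norm_num

theorem toPlane_mem_trace_of_next {x b : Pt} (h : (x, b) ∈ c.steps) : toPlane x ∈ c.trace := by
  obtain ⟨k, hk, e⟩ := h
  obtain ⟨rfl, -⟩ := Prod.mk.inj e
  exact Set.mem_biUnion (Finset.mem_range.2 hk) (left_mem_segment _ _ _)

theorem horizontal_ne (x : Pt) : ((x.1 + 1, x.2) : Pt) ≠ (x.1 - 1, x.2) := fun e => by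
  have := congrArg Prod.fst e
  simp only at this
  omega

theorem abs_corner_le (h : ∀ s ∈ c.steps, IsUnitStep s) (x : Pt) : |corner c.faceRot x| ≤ 1 := by
  rw [(isPotential h).corner_eq, abs_le]
  have h1 := ind_next_add_le (c := c) (x := x) (horizontal_ne x)
  have h2 := ind_prev_add_le (c := c) (x := x) (horizontal_ne x)
  have n1 := ind_nonneg c.steps (x, (x.1 + 1, x.2))
  have n2 := ind_nonneg c.steps (x, (x.1 - 1, x.2))
  have n3 := ind_nonneg c.steps ((x.1 + 1, x.2), x)
  have n4 := ind_nonneg c.steps ((x.1 - 1, x.2), x)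
  constructor <;> linarith

/-- A positive corner has a horizontal step leaving it and none entering it, so the path must arrive
vertically. -/
theorem mem_ver0_of_corner_pos (h : ∀ s ∈ c.steps, IsUnitStep s) {x : Pt}
    (hx : 0 < corner c.faceRot x) : x ∈ c.ver0 := by
  rw [(isPotential h).corner_eq] at hx
  have h1 := ind_next_add_le (c := c) (x := x) (horizontal_ne x)
  have n1 := ind_nonneg c.steps ((x.1 + 1, x.2), x)
  have n2 := ind_nonneg c.steps ((x.1 - 1, x.2), x)
  obtain ⟨b, hb, hb2⟩ : ∃ b, (x, b) ∈ c.steps ∧ x.2 = b.2 := by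
    rcases lt_or_ge 0 (ind c.steps (x, (x.1 + 1, x.2))) with hp | hp
    · exact ⟨_, mem_of_ind_pos hp, rfl⟩
    · exact ⟨_, mem_of_ind_pos (by linarith : 0 < ind c.steps (x, (x.1 - 1, x.2))), rfl⟩
  obtain ⟨a, ha⟩ := exists_prev hb
  refine ⟨a, b, ha, hb, ?_, hb2⟩
  have ha1 := ind_of_mem ha
  obtain ⟨a1, a2⟩ := a
  obtain ⟨x1, x2⟩ := x
  rcases h _ ha with e | e | e | e <;> simp only [Prod.mk.injEq] at e <;> obtain ⟨rfl, rfl⟩ := e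
  · simp only [add_sub_cancel_right] at *
    linarith
  · simp only [sub_add_cancel] at *
    linarith
  · rfl
  · rfl

theorem mem_ver1_of_corner_neg (h : ∀ s ∈ c.steps, IsUnitStep s) {x : Pt}
    (hx : corner c.faceRot x < 0) : x ∈ c.ver1 := by
  rw [(isPotential h).corner_eq] at hx
  have h1 := ind_prev_add_le (c := c) (x := x) (horizontal_ne x)
  have n1 := ind_nonneg c.steps (x, (x.1 + 1, x.2))
  have n2 := ind_nonneg c.steps (x, (x.1 - 1, x.2))
  obtain ⟨a, ha, ha2⟩ : ∃ a, (a, x) ∈ c.steps ∧ a.2 = x.2 := by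
    rcases lt_or_ge 0 (ind c.steps ((x.1 + 1, x.2), x)) with hp | hp
    · exact ⟨_, mem_of_ind_pos hp, rfl⟩
    · exact ⟨_, mem_of_ind_pos (by linarith : 0 < ind c.steps ((x.1 - 1, x.2), x)), rfl⟩
  obtain ⟨b, hb⟩ := exists_next ha
  refine ⟨a, b, ha, hb, ha2, ?_⟩
  have hb1 := ind_of_mem hb
  rcases h _ hb with e | e | e | e <;> simp only at e <;> subst e
  · linarith
  · linarith
  · rfl
  · rfl

theorem toPlane_mem_trace (h : ∀ s ∈ c.steps, IsUnitStep s) {x : Pt}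
    (hx : corner c.faceRot x ≠ 0) : toPlane x ∈ c.trace := by
  rcases lt_or_gt_of_ne hx with hx | hx
  · obtain ⟨-, b, -, hb, -⟩ := mem_ver1_of_corner_neg h hx
    exact toPlane_mem_trace_of_next hb
  · obtain ⟨-, b, -, hb, -⟩ := mem_ver0_of_corner_pos h hx
    exact toPlane_mem_trace_of_next hb

end LatticeCycle

/-! ### Decompositions into simple polygons -/

theorem IsPotential.eq_sum {ι : Type*} [Fintype ι] {F : Pt → ℤ} {E : Set (Pt × Pt)}
    {G : ι → Pt → ℤ} {C : ι → Set (Pt × Pt)} (hF : IsPotential F E)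
    (hG : ∀ k, IsPotential (G k) (C k)) (h : ∀ s, ind E s = ∑ k, ind (C k) s) (p : Pt) :
    F p = ∑ k, G k p := by
  obtain ⟨M, hM⟩ := hF.zero
  choose N hN using fun k => (hG k).zero
  have hNle : ∀ k, N k ≤ ∑ k, |N k| := fun k =>
    (le_abs_self _).trans (Finset.single_le_sum (f := fun k => |N k|) (fun k _ => abs_nonneg _)
      (Finset.mem_univ k))
  refine row_induction (Q := fun i => F (i, p.2) = ∑ k, G k (i, p.2)) (max M (∑ k, |N k|))
    (fun i hi => ?_) (fun i hi => ?_) p.1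
  · rw [hM _ (Or.inl (by simp only; omega)), Finset.sum_eq_zero]
    exact fun k _ => hN k _ (Or.inl (by have := hNle k; simp only; omega))
  · have h1 := hF.vert i p.2
    have h2 : ∑ k, G k (i - 1, p.2) - ∑ k, G k (i, p.2) =
        ∑ k, ind (C k) ((i, p.2), (i, p.2 + 1)) - ∑ k, ind (C k) ((i, p.2 + 1), (i, p.2)) := by
      rw [← Finset.sum_sub_distrib, ← Finset.sum_sub_distrib]
      exact Finset.sum_congr rfl fun k _ => (hG k).vert i p.2
    rw [h, h] at h1
    linarith

namespace SimpleDecomposition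

variable {P : LatticePolytope} (D : SimpleDecomposition P)

/-- The rotation number of the polytope with boundary `P_i` and all `Q_{ij}`. -/
def part (i : Fin D.m) (p : Pt) : ℤ := (D.outer i).faceRot p + ∑ j, (D.inner i j).faceRot p

theorem outer_unit (i : Fin D.m) : ∀ s ∈ (D.outer i).steps, IsUnitStep s := fun _ hs =>
  LatticePolytope.isUnitStep_of_mem_steps (D.outer_inBoundary i hs)

theorem inner_unit (i : Fin D.m) (j : Fin (D.n i)) : ∀ s ∈ (D.inner i j).steps, IsUnitStep s :=
  fun _ hs => LatticePolytope.isUnitStep_of_mem_steps (D.inner_inBoundary i j hs)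

theorem faceRot_eq_sum (p : Pt) : P.faceRot p = ∑ i, D.part i p := by
  let c : Fin D.m ⊕ (Σ i : Fin D.m, Fin (D.n i)) → LatticeCycle :=
    Sum.elim D.outer fun q => D.inner q.1 q.2
  have hc : ∀ k, (c k).InBoundary P := by
    rintro (i | ⟨i, j⟩)
    exacts [D.outer_inBoundary i, D.inner_inBoundary i j]
  have key := P.isPotential.eq_sum (G := fun k => (c k).faceRot) (C := fun k => (c k).steps)
    (fun k => LatticeCycle.isPotential fun s hs =>
      LatticePolytope.isUnitStep_of_mem_steps (hc k hs)) (fun s => ?_) p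
  · rw [key, Fintype.sum_sum_type, Fintype.sum_sigma, ← Finset.sum_add_distrib]
    rfl
  · by_cases hs : s ∈ P.steps
    · obtain ⟨k, hk, huniq⟩ := D.partition s hs
      rw [ind_of_mem hs, Finset.sum_eq_single_of_mem k (Finset.mem_univ k)]
      · exact (ind_of_mem hk).symm
      · exact fun l _ hl => ind_of_notMem fun h => hl (huniq l h)
    · rw [ind_of_notMem hs, Finset.sum_eq_zero]
      exact fun k _ => ind_of_notMem fun h => hs (hc k h)

theorem trace_inner_subset (i : Fin D.m) (j : Fin (D.n i)) :
    (D.inner i j).trace ⊆ (D.outer i).inside :=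
  Set.subset_union_right.trans (D.inner_subset i j)

theorem inner_eq_zero {i : Fin D.m} {p : Pt} (h : (D.outer i).faceRot p = 0) (j : Fin (D.n i)) :
    (D.inner i j).faceRot p = 0 := by
  by_contra hne
  have h1 := (LatticeCycle.center_mem_inside (D.inner_unit i j)).2 hne
  exact (LatticeCycle.center_mem_inside (D.outer_unit i)).1
    (D.inner_subset i j (Or.inl h1)) h

theorem outer_ne_zero {i : Fin D.m} {p : Pt} (h : D.part i p ≠ 0) :
    (D.outer i).faceRot p ≠ 0 := by
  intro h0
  refine h ?_
  rw [part, h0, Finset.sum_eq_zero fun j _ => D.inner_eq_zero h0 j, add_zero]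

theorem inner_unique {i : Fin D.m} {p : Pt} {j k : Fin (D.n i)}
    (hj : (D.inner i j).faceRot p ≠ 0) (hk : (D.inner i k).faceRot p ≠ 0) : j = k := by
  by_contra hne
  exact Set.disjoint_left.1 (D.inner_disjoint i j k hne)
    (Or.inl ((LatticeCycle.center_mem_inside (D.inner_unit i j)).2 hj))
    (Or.inl ((LatticeCycle.center_mem_inside (D.inner_unit i k)).2 hk))

/-- A part can be nonzero only inside P_i, where the outer path contributes a fixed sign. The holes
are disjoint, so at any square they contribute at most 1 in modulus and cannot reverse this sign,
whatever their orientations. -/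
theorem part_sign (i : Fin D.m) : (∀ p, 0 ≤ D.part i p) ∨ ∀ p, D.part i p ≤ 0 := by
  obtain ⟨ε, hε, h⟩ := LatticeCycle.exists_sign (D.outer_unit i) fun s hs h' =>
    LatticePolytope.swap_notMem_steps (D.outer_inBoundary i hs) (D.outer_inBoundary i h')
  have hsum : ∀ p, |∑ j, (D.inner i j).faceRot p| ≤ 1 := by
    intro p
    by_cases hex : ∃ j, (D.inner i j).faceRot p ≠ 0
    · obtain ⟨j, hj⟩ := hex
      rw [Finset.sum_eq_single_of_mem j (Finset.mem_univ j)]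
      · obtain ⟨δ, hδ, h'⟩ := LatticeCycle.exists_sign (D.inner_unit i j) fun s hs h' =>
          LatticePolytope.swap_notMem_steps (D.inner_inBoundary i j hs)
            (D.inner_inBoundary i j h')
        rw [(h' p).resolve_left hj]
        rcases hδ with rfl | rfl <;> norm_num
      · intro k _ hk
        by_contra hne
        exact hk (D.inner_unique hne hj)
    · push Not at hex
      rw [Finset.sum_eq_zero fun j _ => hex j]
      norm_num
  have hval : ∀ p, D.part i p = 0 ∨ (D.outer i).faceRot p = ε := by
    intro p
    by_cases h0 : D.part i p = 0
    · exact Or.inl h0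
    · exact Or.inr ((h p).resolve_left (D.outer_ne_zero h0))
  rcases hε with rfl | rfl
  · refine Or.inl fun p => (hval p).elim (fun e => e.ge) fun e => ?_
    rw [part, e]
    linarith [(abs_le.1 (hsum p)).1]
  · refine Or.inr fun p => (hval p).elim (fun e => e.le) fun e => ?_
    rw [part, e]
    linarith [(abs_le.1 (hsum p)).2]

/-- Two different P_i share at most one boundary point, and the centre of a square lies on no path.
-/
theorem part_disjoint {i j : Fin D.m} (hij : i ≠ j) {p : Pt} (hi : D.part i p ≠ 0) :
    D.part j p = 0 := by
  by_contra hj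
  have h1 := (LatticeCycle.center_mem_inside (D.outer_unit i)).2 (D.outer_ne_zero hi)
  have h2 := (LatticeCycle.center_mem_inside (D.outer_unit j)).2 (D.outer_ne_zero hj)
  rcases D.outer_inter i j hij with h | ⟨x, -, hx, h⟩
  · exact Set.disjoint_left.1 h (Or.inl h1) (Or.inl h2)
  · have h3 := h.subset ⟨Or.inl h1, Or.inl h2⟩
    rw [Set.mem_singleton_iff] at h3
    exact LatticeCycle.center_notMem_trace (D.outer_unit i) p (h3 ▸ hx.1)

theorem abs_faceRot_eq_sum (p : Pt) : |P.faceRot p| = ∑ i, |D.part i p| := by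
  rw [D.faceRot_eq_sum]
  by_cases hex : ∃ i, D.part i p ≠ 0
  · obtain ⟨i, hi⟩ := hex
    have h0 : ∀ j ∈ Finset.univ, j ≠ i → D.part j p = 0 := fun j _ hj => D.part_disjoint hj.symm hi
    rw [Finset.sum_eq_single_of_mem i (Finset.mem_univ i) h0,
      Finset.sum_eq_single_of_mem i (Finset.mem_univ i) fun j hj hji => by rw [h0 j hj hji, abs_zero]]
  · push Not at hex
    rw [Finset.sum_eq_zero fun i _ => hex i,
      Finset.sum_eq_zero fun i _ => by rw [hex i, abs_zero], abs_zero]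

theorem part_eq_zero {p : Pt} (h : P.faceRot p = 0) (i : Fin D.m) : D.part i p = 0 := by
  have := D.abs_faceRot_eq_sum p
  rw [h, abs_zero, eq_comm, Finset.sum_eq_zero_iff_of_nonneg fun i _ => abs_nonneg _] at this
  exact abs_eq_zero.1 (this i (Finset.mem_univ i))

theorem corner_part (i : Fin D.m) (x : Pt) : corner (D.part i) x =
    corner (D.outer i).faceRot x + ∑ j, corner (D.inner i j).faceRot x := by
  rw [← corner_sum, ← corner_add]
  rfl

theorem corner_part_of_mem_trace {i : Fin D.m} {x : Pt} (hx : toPlane x ∈ (D.outer i).trace) :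
    corner (D.part i) x = corner (D.outer i).faceRot x := by
  rw [corner_part, Finset.sum_eq_zero, add_zero]
  intro j _
  by_contra hne
  exact (D.trace_inner_subset i j (LatticeCycle.toPlane_mem_trace (D.inner_unit i j) hne)).1 hx

/-- Every corner of a part is a corner of just one of its closed paths. -/
theorem corner_part_cases (i : Fin D.m) (x : Pt) : corner (D.part i) x = 0 ∨
    (toPlane x ∈ (D.outer i).trace ∧ corner (D.part i) x = corner (D.outer i).faceRot x) ∨
    ∃ j, toPlane x ∈ (D.inner i j).trace ∧
      corner (D.part i) x = corner (D.inner i j).faceRot x := by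
  by_cases h0 : corner (D.outer i).faceRot x = 0
  · by_cases hex : ∃ j, corner (D.inner i j).faceRot x ≠ 0
    · obtain ⟨j, hj⟩ := hex
      have hjt := LatticeCycle.toPlane_mem_trace (D.inner_unit i j) hj
      refine Or.inr (Or.inr ⟨j, hjt, ?_⟩)
      rw [corner_part, h0, zero_add, Finset.sum_eq_single_of_mem j (Finset.mem_univ j)]
      intro k _ hk
      by_contra hne
      exact Set.disjoint_left.1 (D.inner_disjoint i k j hk)
        (Or.inr (LatticeCycle.toPlane_mem_trace (D.inner_unit i k) hne)) (Or.inr hjt)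
    · push Not at hex
      left
      rw [corner_part, h0, Finset.sum_eq_zero fun j _ => hex j, add_zero]
  · have ht := LatticeCycle.toPlane_mem_trace (D.outer_unit i) h0
    exact Or.inr (Or.inl ⟨ht, D.corner_part_of_mem_trace ht⟩)

theorem abs_corner_part_le (i : Fin D.m) (x : Pt) : |corner (D.part i) x| ≤ 1 := by
  rcases D.corner_part_cases i x with h | ⟨-, h⟩ | ⟨j, -, h⟩ <;> rw [h]
  · norm_num
  · exact LatticeCycle.abs_corner_le (D.outer_unit i) x
  · exact LatticeCycle.abs_corner_le (D.inner_unit i j) x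

theorem mem_region_of_corner {i : Fin D.m} {x : Pt} (hx : corner (D.part i) x ≠ 0) :
    toPlane x ∈ (D.outer i).region := by
  rcases D.corner_part_cases i x with h | ⟨h, -⟩ | ⟨j, h, -⟩
  · exact absurd h hx
  · exact Or.inr h
  · exact Or.inl (D.trace_inner_subset i j h)

/-- A common corner must be the single point shared by P_i and P_j. It lies on both outer paths,
hence away from all holes, and the signs of the corners tell its type in each polygon. -/
theorem mem_ver_of_corners {i j : Fin D.m} (hij : i ≠ j) {x : Pt}
    (hi : corner (D.part i) x < 0) (hj : 0 < corner (D.part j) x) :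
    x ∈ (D.outer i).ver1 ∧ x ∈ (D.outer j).ver0 := by
  have h1 := D.mem_region_of_corner hi.ne
  have h2 := D.mem_region_of_corner hj.ne'
  rcases D.outer_inter i j hij with h | ⟨y, -, hy, h⟩
  · exact absurd h2 (Set.disjoint_left.1 h h1)
  · have h3 : toPlane x = toPlane y := h.subset ⟨h1, h2⟩
    rw [← h3] at hy
    rw [D.corner_part_of_mem_trace hy.1] at hi
    rw [D.corner_part_of_mem_trace hy.2] at hj
    exact ⟨LatticeCycle.mem_ver1_of_corner_neg (D.outer_unit i) hi,
      LatticeCycle.mem_ver0_of_corner_pos (D.outer_unit j) hj⟩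

theorem exists_minimal (hD : D.NoDirectedCycle) {U : Finset (Fin D.m)} (hU : U.Nonempty) :
    ∃ j ∈ U, ∀ i ∈ U, ¬ ∃ x, x ∈ (D.outer i).ver1 ∧ x ∈ (D.outer j).ver0 := by
  let r := Relation.TransGen fun i j : Fin D.m =>
    ∃ x, x ∈ (D.outer i).ver1 ∧ x ∈ (D.outer j).ver0
  have : IsTrans (Fin D.m) r := ⟨fun _ _ _ => Relation.TransGen.trans⟩
  have : Std.Irrefl r := ⟨hD⟩
  have hwf : WellFounded r := Finite.wellFounded_of_trans_of_irrefl r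
  obtain ⟨j, hj, hmin⟩ := hwf.has_min (U : Set (Fin D.m)) hU
  exact ⟨j, hj, fun i hi h => hmin i hi (.single h)⟩

/-- U is the set of parts still to be processed, and the hypothesis on S says that Ver₁(P) results
from S by deleting and adding their corners. A part that is minimal for the relation of meeting at
vertices can be processed at once by `exists_rectChain_of_corner`. -/
theorem rectChain_of_noDirectedCycle (hD : D.NoDirectedCycle) {n : ℕ} :
    ∀ (U : Finset (Fin D.m)) (S : Finset Pt), U.card = n → BiInj S →
      (∀ x, (if x ∈ S then 1 else 0 : ℤ) =
        (if x ∈ P.ver1 then 1 else 0) + ∑ i ∈ U, corner (D.part i) x) →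
      RectChain S P.ver1 (∑ i ∈ U, ∑ p ∈ P.faces, |D.part i p|) := by
  induction n with
  | zero =>
    intro U S hU _ hS
    rw [Finset.card_eq_zero] at hU
    subst hU
    have : S = P.ver1 := by
      ext x
      have := hS x
      simp only [Finset.sum_empty, add_zero] at this
      split_ifs at this <;> simp_all
    rw [this]
    exact .refl _
  | succ n ih =>
    intro U S hU hSB hS
    obtain ⟨j, hj, hmin⟩ := D.exists_minimal hD (Finset.card_pos.1 (by omega : 0 < U.card))
    obtain ⟨N, hN⟩ := P.exists_box
    obtain ⟨T, hTB, hchain, hT⟩ := exists_rectChain_of_corner (f := D.part j) P.faces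
      (fun p hp => D.part_eq_zero (hN p hp) j)
      (fun p hp => D.part_eq_zero (not_not.1 (mt LatticePolytope.mem_faces.2 hp)) j)
      (D.part_sign j) (D.abs_corner_part_le j) hSB (by
        intro x hx
        by_contra hxS
        have h1 := hS x
        rw [if_neg hxS, ← Finset.add_sum_erase _ _ hj] at h1
        -- By minimality no other remaining part has a negative corner here, so nothing cancels the
        -- positive corner of `j`, and the point is already present in S.
        have h2 : 0 ≤ ∑ i ∈ U.erase j, corner (D.part i) x := by
          refine Finset.sum_nonneg fun i hi => ?_
          by_contra hneg
          exact hmin i (Finset.mem_of_mem_erase hi)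
            ⟨x, D.mem_ver_of_corners (Finset.ne_of_mem_erase hi) (not_le.1 hneg) hx⟩
        have h3 : (0 : ℤ) ≤ if x ∈ P.ver1 then 1 else 0 := by split_ifs <;> norm_num
        linarith)
    rw [← Finset.add_sum_erase _ _ hj]
    refine hchain.trans (ih (U.erase j) T ?_ hTB fun x => ?_)
    · rw [Finset.card_erase_of_mem hj, hU, Nat.add_sub_cancel]
    · rw [hT, hS, ← Finset.add_sum_erase _ _ hj]
      ring

theorem rectChain (hD : D.NoDirectedCycle) : RectChain P.ver0 P.ver1 P.faceArea := by
  have h := D.rectChain_of_noDirectedCycle hD Finset.univ P.ver0 rfl P.biInj_ver0 (by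
    intro x
    rw [← corner_sum, ← corner_cnt, ← corner_cnt]
    have : (fun p => ∑ i, D.part i p) = P.faceRot := funext fun p => (D.faceRot_eq_sum p).symm
    rw [this]
    simp only [corner, LatticePolytope.faceRot]
    ring)
  rw [Finset.sum_comm, Finset.sum_congr rfl fun p _ => (D.abs_faceRot_eq_sum p).symm] at h
  exact h

end SimpleDecomposition

end PartialMatching

end

/-! ### The theorem -/

theorem mainTheorem4 (Δ Δ' : Finset PartialMatching.Pt)
    (hΔ : PartialMatching.IsLatticePresentation Δ)
    (hΔ' : PartialMatching.IsLatticePresentation Δ')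
    (P : PartialMatching.LatticePolytope) (hP : P.IsAssociated Δ Δ')
    (hdisj : P.DisjointFromMirror)
    (T : PartialMatching.Transformation Δ Δ') (hmin : T.HasMinimalArea)
    (hcond : P.Condition1 ∨
      ∃ D : PartialMatching.SimpleDecomposition P,
        D.NoDirectedCycle ∨ (T.area : ℝ) = P.absArea) :
    T.IsDescribedBy P ∧ T.ExchangesNestingCrossing := by
  have harea : T.area ≤ P.faceArea := by
    rcases hcond with h | ⟨D, h | h⟩
    · exact hmin.area_le hΔ hP h.rectChain
    · exact hmin.area_le hΔ hP (D.rectChain h)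
    · rw [P.absArea_eq] at h
      exact_mod_cast h.le
  exact ⟨T.isDescribedBy_of_area_le hΔ hP hdisj harea,
    T.exchanges_of_area_le hΔ hP hdisj harea⟩
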